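/- Let $L$ be the infinite hexagonal lattice, oriented such that some of its edges are vertical. A \emph{regular $m$-tier strip $S$ of length $n$} ($m,n\ge 1$) is the subgraph of $L$ formed by all vertices and edges of the hexagons in $m$ consecutive horizontal rows (tiers) $1,\dots,m$, where each tier consists of a positive number of adjacent hexagons, the left ends of any two consecutive tiers differ by exactly half a hexagon unit, so do their right ends, and the first and the last tier both consist of $n$ hexagons. Let the interface $i_k$ be the set of vertical edges of tier $k$. A \emph{Kekulé structure} of $S$ is a perfect matching of $S$; $S$ is \emph{Kekuléan} if it has one. A \emph{proper sextet} of a Kekulé structure $K$ is a hexagon of $S$ whose right vertical edge, upper left edge and lower left edge belong to $K$. Let $a(S,k)$ be the number of Kekulé structures of $S$ with exactly $k$ proper sextets. A \emph{Clar cover} of $S$ is a spanning subgraph of $S$ each of whose connected components is isomorphic to $K_2$ or to the 6-cycle $C_6$; its \emph{order} is the number of its components isomorphic to $C_6$. Let $c_k$ be the number of Clar covers of $S$ of order $k$, let $Cl$ be the largest order of a Clar cover of $S$, and let $\mathrm{ZZ}(S,x)=\sum_{k=0}^{Cl}c_kx^k$. For a finite poset $P$, let $\Omega^\circ_P(n)$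 be the number of strictly order-preserving maps $P\to\{1,\dots,n\}$, and let $\mathrm{E}^\circ_P(n,z)=\sum_{Q\subset P}\Omega^\circ_Q(n)\,z^{|Q|}$, where the sum runs over all induced subposets $Q$ of $P$. Suppose that $S$ is Kekuléan, and put $\mathrm{ord}(i_k)=|i_k|-n$, which is then nonnegative. Let $\mathcal S$ be the set of the double interface bonds $s_{k,j}$ with $1\le k\le m$ and $1\le j\le \mathrm{ord}(i_k)$, with the strict partial order $<_{\mathcal S}$ that is the transitive closure of the following relation: $s_{k,j}\lessdot s_{k',j'}$ if and only if $|k'-k|=1$ and either $j'=j$ and the leftmost edge of $i_k\cup i_{k'}$ belongs to $i_k$, or $j'=j+1$ and the leftmost edge of $i_k\cup i_{k'}$ belongs to $i_{k'}$. \textbf{Theorem.} Let $S$ be a Kekuléan regular $m$-tier strip of length $n$ with the associated poset $\mathcal S$. Then for every integer $k\ge 0$ $$a(S,k)=\sum_{\substack{\mathcal A\subset\mathcal S\\ |\mathcal A|=k}}\Omega^\circ_{\mathcal A}(n),$$ where the sum runs over the induced subposets of $\mathcal S$ with $k$ elements, and, as polynomials in $x$, $$\mathrm{ZZ}(S,x)=\mathrm{E}^\circ_{\mathcal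 S}(n,x+1).$$ -/

import Mathlib

open Polynomial

/-! ### Strict order polynomials -/

/-- The value `Ω°_P(n)` of the strict order polynomial of a finite poset `P`: the number of strictly
order-preserving maps from `P` to the chain `{1, …, n}`. -/
noncomputable def strictOrderPoly (P : Type) [PartialOrder P] (n : ℕ) : ℕ :=
  Nat.card {φ : P → Set.Icc 1 n // StrictMono φ}

/-- The extended strict order polynomial `E°_P(n, z) = ∑_{Q ⊆ P} Ω°_Q(n) z^{|Q|}`, a polynomial
in `z`; the sum runs over all induced subposets `Q` of `P`. -/
noncomputable def extStrictOrderPoly (P : Type) [PartialOrder P] [Fintype P] (n : ℕ) : ℤ[X] :=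
  ∑ Q : Finset P, C (strictOrderPoly Q n : ℤ) * X ^ Q.card

/-! ### The hexagonal lattice -/

/-- The infinite hexagonal lattice, oriented such that some of its edges are vertical.
The vertices of the lattice lie on horizontal zigzag lines, numbered by `ℤ` from top to bottom.
The vertex `(r, c)` lies on the zigzag line number `r`, and `c` is its horizontal coordinate, in
units of half the width of a hexagon. The slanted edges join neighbours on the same zigzag line;
a vertical edge leads down from `(r, c)` to `(r + 1, c)` exactly when `r + c` is even. -/
def hexLattice : SimpleGraph (ℤ × ℤ) :=
  SimpleGraph.fromRel fun u v =>
    (u.1 = v.1 ∧ v.2 = u.2 + 1) ∨ (v.1 = u.1 + 1 ∧ v.2 = u.2 ∧ Even (u.1 + u.2))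

/-- The six vertices of the hexagon `h = (r, c)`, with `r + c` odd, which lies between the zigzag
lines `r` and `r + 1` and whose centre has the horizontal coordinate `c`. Its top and bottom
corners are `(r, c)` and `(r + 1, c)`; its vertical edges are in the columns `c - 1` and `c + 1`. -/
def hexVerts (h : ℤ × ℤ) : Set (ℤ × ℤ) :=
  {v | (v.1 = h.1 ∨ v.1 = h.1 + 1) ∧ (v.2 = h.2 - 1 ∨ v.2 = h.2 ∨ v.2 = h.2 + 1)}

/-! ### Kekulé structures, Clar covers and the Zhang–Zhang polynomial -/

/-- `K` is a Kekulé structure of `B`: a spanning subgraph of `B` that is a perfect matching. -/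
def IsKekule (B K : hexLattice.Subgraph) : Prop :=
  K ≤ B ∧ K.verts = B.verts ∧ K.IsMatching

/-- `D` is a Clar cover of `B`: a spanning subgraph of `B` each of whose connected components is
isomorphic to `K₂` or to `C₆`. -/
def IsClarCover (B D : hexLattice.Subgraph) : Prop :=
  D ≤ B ∧ D.verts = B.verts ∧ ∀ c : D.coe.ConnectedComponent,
    Nonempty (c.toSimpleGraph ≃g (⊤ : SimpleGraph (Fin 2))) ∨
      Nonempty (c.toSimpleGraph ≃g SimpleGraph.cycleGraph 6)

/-- The order of a Clar cover: the number of its connected components isomorphic to `C₆`. -/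
noncomputable def clarOrder (D : hexLattice.Subgraph) : ℕ :=
  {c : D.coe.ConnectedComponent | Nonempty (c.toSimpleGraph ≃g SimpleGraph.cycleGraph 6)}.ncard

/-- The number `c_k` of Clar covers of `B` of order `k`. -/
noncomputable def clarCount (B : hexLattice.Subgraph) (k : ℕ) : ℕ :=
  {D : hexLattice.Subgraph | IsClarCover B D ∧ clarOrder D = k}.ncard

/-- The Clar number of `B`: the maximal order of a Clar cover of `B`. -/
noncomputable def clarNumber (B : hexLattice.Subgraph) : ℕ :=
  sSup {k | ∃ D, IsClarCover B D ∧ clarOrder D = k}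

/-- The Zhang–Zhang polynomial `ZZ(B, x) = ∑_{k=0}^{Cl} c_k x^k`. -/
noncomputable def zzPoly (B : hexLattice.Subgraph) : ℤ[X] :=
  ∑ k ∈ Finset.range (clarNumber B + 1), C (clarCount B k : ℤ) * X ^ k

/-! ### Regular strips -/

/-- A regular `m`-tier strip of length `n`. The tiers are numbered from top to bottom by
`0, …, m - 1`; the tier `k` lies between the zigzag lines `k` and `k + 1`. It consists of `len k`
adjacent hexagons, and its leftmost vertical edge is in the column `first k`. -/
structure RegularStrip (m n : ℕ) where
  first : Fin m → ℤ
  len : Fin m → ℕ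
  tiers_pos : 0 < m
  len_pos : ∀ k, 0 < len k
  /-- the lattice has a vertical edge at the place where tier `k` is to begin -/
  even_first : ∀ k : Fin m, Even (((k : ℕ) : ℤ) + first k)
  /-- the left ends of adjacent tiers differ by half a hexagon -/
  left_step : ∀ k k' : Fin m, (k' : ℕ) = k + 1 → |first k' - first k| = 1
  /-- the right ends of adjacent tiers differ by half a hexagon -/
  right_step : ∀ k k' : Fin m, (k' : ℕ) = k + 1 →
    |(first k' + 2 * len k') - (first k + 2 * len k)| = 1
  len_top : ∀ k : Fin m, (k : ℕ) = 0 → len k = n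
  len_bottom : ∀ k : Fin m, (k : ℕ) + 1 = m → len k = n

namespace RegularStrip

variable {m n : ℕ}

/-- The hexagons of the strip, in the notation of `hexVerts`. -/
def hexagons (S : RegularStrip m n) : Set (ℤ × ℤ) :=
  {h | ∃ k : Fin m, ∃ j < S.len k, h = (((k : ℕ) : ℤ), S.first k + 2 * j + 1)}

/-- The benzenoid graph of the strip: all vertices and edges of its hexagons. -/
def graph (S : RegularStrip m n) : hexLattice.Subgraph where
  verts := {v | ∃ h ∈ S.hexagons, v ∈ hexVerts h}
  Adj u v := hexLattice.Adj u v ∧ ∃ h ∈ S.hexagons, u ∈ hexVerts h ∧ v ∈ hexVerts h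
  adj_sub h := h.1
  edge_vert := fun ⟨_, h, hh, hu, _⟩ => ⟨h, hh, hu⟩
  symm := ⟨fun _ _ ⟨ha, h, hh, hu, hv⟩ => ⟨ha.symm, h, hh, hv, hu⟩⟩

/-- The interface of tier `k`: the vertical edges of the strip between the zigzag lines `k` and
`k + 1`. -/
def interface (S : RegularStrip m n) (k : Fin m) : Set (Sym2 (ℤ × ℤ)) :=
  {e | e ∈ S.graph.edgeSet ∧ ∃ c : ℤ, e = s((((k : ℕ) : ℤ), c), (((k : ℕ) : ℤ) + 1, c))}

/-- The bonds of the interface of tier `k`, from left to right, are in the columns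
`first k, first k + 2, …, first k + 2 * len k`. -/
theorem mem_interface (S : RegularStrip m n) (k : Fin m) (e : Sym2 (ℤ × ℤ)) :
    e ∈ S.interface k ↔ ∃ j : ℕ, j ≤ S.len k ∧
      e = s((((k : ℕ) : ℤ), S.first k + 2 * j), (((k : ℕ) : ℤ) + 1, S.first k + 2 * j)) := by
  have hev := S.even_first k
  have hpos := S.len_pos k
  constructor
  · rintro ⟨he, c, rfl⟩
    rw [SimpleGraph.Subgraph.mem_edgeSet] at he
    obtain ⟨hadj, h, ⟨k', j, hj, rfl⟩, hu, hv⟩ := he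
    simp only [hexLattice, SimpleGraph.fromRel_adj, hexVerts, Set.mem_ofPred_eq] at hadj hu hv
    have hk : k' = k := by
      apply Fin.ext
      omega
    subst hk
    rcases hadj with ⟨-, hadj⟩
    have hc : Even ((k' : ℤ) + c) := by
      rcases hadj with (h | h) | (h | h)
      · omega
      · exact h.2.2
      · omega
      · omega
    rw [Int.even_iff] at hc hev
    rcases hu.2 with h | h | h
    · exact ⟨j, by omega, by rw [show c = S.first k' + 2 * (j : ℤ) by omega]⟩
    · omega
    · exact ⟨j + 1, by omega, by
        rw [show c = S.first k' + 2 * ((j + 1 : ℕ) : ℤ) by push_cast; omega]⟩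
  · rintro ⟨j, hj, rfl⟩
    refine ⟨?_, _, rfl⟩
    rw [SimpleGraph.Subgraph.mem_edgeSet]
    refine ⟨?_, ?_⟩
    · simp only [hexLattice, SimpleGraph.fromRel_adj]
      refine ⟨by simp, Or.inl (Or.inr ⟨trivial, trivial, ?_⟩)⟩
      rw [Int.even_iff] at hev ⊢
      omega
    · rcases Nat.lt_or_ge j (S.len k) with hlt | hge
      · refine ⟨_, ⟨k, j, hlt, rfl⟩, ⟨Or.inl rfl, Or.inl ?_⟩, ⟨Or.inr rfl, Or.inl ?_⟩⟩ <;>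
          simp
      · refine ⟨_, ⟨k, j - 1, by omega, rfl⟩, ⟨Or.inl rfl, Or.inr (Or.inr ?_)⟩,
          ⟨Or.inr rfl, Or.inr (Or.inr ?_)⟩⟩ <;> simp only <;> omega

/-- The order `|i| - n` of an interface `i`; it is nonnegative if the strip is Kekuléan. -/
noncomputable def ord (S : RegularStrip m n) (k : Fin m) : ℕ :=
  (S.interface k).ncard - n

/-- The set `𝒮 = {s_{k,j}}` of double interface bonds of the strip. Tiers `k` and indices
`j` are counted from `0`. -/
structure Dib (S : RegularStrip m n) where
  tier : Fin m
  idx : Fin (S.ord tier)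

namespace Dib

variable {S : RegularStrip m n}

/-- The relation `s_{k,j} ⋖ s_{k',j'}`: the tiers `k` and `k'` are adjacent, and `j' - j` is `0`
if the leftmost interface bond of the fragment between them belongs to the interface of `k`
and `1` if it belongs to the interface of `k'`. -/
def Cover (s t : S.Dib) : Prop :=
  ((t.tier : ℕ) = s.tier + 1 ∨ (s.tier : ℕ) = t.tier + 1) ∧
    ((S.first s.tier < S.first t.tier ∧ (t.idx : ℕ) = s.idx) ∨
      (S.first t.tier < S.first s.tier ∧ (t.idx : ℕ) = s.idx + 1))

theorem Cover.column {s t : S.Dib} (h : Cover s t) :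
    S.first t.tier + 2 * (t.idx : ℤ) = S.first s.tier + 2 * (s.idx : ℤ) + 1 := by
  obtain ⟨ht, hj⟩ := h
  have hstep : |S.first t.tier - S.first s.tier| = 1 := by
    rcases ht with ht | ht
    · exact S.left_step _ _ ht
    · rw [abs_sub_comm]
      exact S.left_step _ _ ht
  rw [abs_eq (by norm_num)] at hstep
  omega

theorem column_lt_of_transGen {s t : S.Dib} (h : Relation.TransGen Cover s t) :
    S.first s.tier + 2 * (s.idx : ℤ) < S.first t.tier + 2 * (t.idx : ℤ) := by
  induction h with
  | single h => have := h.column; omega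
  | tail _ h ih => have := h.column; omega

/-- The partial order on `𝒮`: its strict part is the transitive closure of `Cover`. -/
instance : PartialOrder S.Dib where
  le := Relation.ReflTransGen Cover
  lt := Relation.TransGen Cover
  le_refl _ := Relation.ReflTransGen.refl
  le_trans _ _ _ := Relation.ReflTransGen.trans
  lt_iff_le_not_ge s t := by
    constructor
    · intro h
      refine ⟨h.to_reflTransGen, fun h' => ?_⟩
      have := column_lt_of_transGen (h.trans_left h')
      omega
    · rintro ⟨h, h'⟩
      rcases Relation.reflTransGen_iff_eq_or_transGen.1 h with rfl | h
      · exact absurd Relation.ReflTransGen.refl h'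
      · exact h
  le_antisymm s t h h' := by
    rcases Relation.reflTransGen_iff_eq_or_transGen.1 h with h | h
    · exact h.symm
    · have := column_lt_of_transGen (h.trans_left h')
      omega

noncomputable instance : Fintype S.Dib :=
  Fintype.ofEquiv (Σ k : Fin m, Fin (S.ord k))
    { toFun := fun p => ⟨p.1, p.2⟩
      invFun := fun s => ⟨s.tier, s.idx⟩
      left_inv := fun _ => rfl
      right_inv := fun _ => rfl }

end Dib

/-- The hexagons of the strip in which a Kekulé structure `K` has a proper sextet: the double bonds
of `K` in the hexagon are its right vertical edge, its upper left edge and its lower left edge. -/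
def properSextets (S : RegularStrip m n) (K : hexLattice.Subgraph) : Set (ℤ × ℤ) :=
  {h | h ∈ S.hexagons ∧
    K.Adj (h.1, h.2 + 1) (h.1 + 1, h.2 + 1) ∧
    K.Adj (h.1, h.2 - 1) (h.1, h.2) ∧
    K.Adj (h.1 + 1, h.2 - 1) (h.1 + 1, h.2)}

/-- The number `a(S, k)` of Kekulé structures of `S` with exactly `k` proper sextets. -/
noncomputable def kekuleCount (S : RegularStrip m n) (k : ℕ) : ℕ :=
  {K : hexLattice.Subgraph | IsKekule S.graph K ∧ (S.properSextets K).ncard = k}.ncard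

end RegularStrip

/-! The proof codes Kekulé structures by weakly order-preserving maps `g : S.Dib → Fin (n + 1)`, so
that proper sextets become the set `minFib g` of elements with nonzero value that are minimal in
their fiber.

Along a zigzag line the vertices are attached alternately to the two adjacent tiers. If each vertex
is matched once, the numbers of vertical double bonds of the two tiers up to a given column differ
by 0 or 1, and this difference determines the horizontal bonds (`alternating_count`,
`IsConfig.tally_sub`). At the right end of the line it fixes the difference of the totals, so tier
`k` has exactly `|i_k| - n` vertical double bonds (`IsConfig.tally_eq_order`). A Kekulé structure is
therefore the same as a placement of the double interface bonds in columns that increase along each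
tier and interlace between adjacent tiers.

Measure the column of a bond from its leftmost position, in units of one hexagon. Leftmost positions
grow by exactly 1 along a cover relation, while displacements count twice, so strict interlacing of
columns is weak monotonicity of displacements. Displacements range over `0, …, n`, whence
`bijective_kekule`. A proper sextet has a double bond `s` as its right edge; it exists exactly when
there is a hexagon to the left of `s` and no bond covered by `s` has the same displacement. This is
membership in `minFib g` (`properSextets_kekule`).

A monotone `g` is recovered from its restriction to `minFib g`, which is strictly monotone with
values in `1, …, n`, and every such map on any subset arises (`card_minFib_eq`). This gives the
formula for `a(S, k)`.

For Clar covers, replacing each hexagonal component by the double bonds of its proper sextet leaves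
a Kekulé structure with some of its proper sextets marked. Proper sextets of one structure are
disjoint, so any subset may be marked (`clarCoverEquiv`). Hence the Zhang–Zhang polynomial is the
sum of `(X + 1) ^ p` over Kekulé structures with `p` proper sextets, and grouping by `minFib`
finishes the proof. -/

/-! ### Weakly order-preserving maps and strict order polynomials -/

open Classical in
/-- The elements on which a map to `{0, …, n}` is nonzero and which are minimal in their fiber. -/
noncomputable def minFib {P : Type} [PartialOrder P] [Fintype P] {n : ℕ} (g : P → Fin (n + 1)) :
    Finset P :=
  {s | g s ≠ 0 ∧ ∀ t < s, g t ≠ g s}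

theorem mem_minFib {P : Type} [PartialOrder P] [Fintype P] {n : ℕ} {g : P → Fin (n + 1)} {s : P} :
    s ∈ minFib g ↔ g s ≠ 0 ∧ ∀ t < s, g t ≠ g s := by
  simp [minFib]

theorem exists_mem_minFib {P : Type} [PartialOrder P] [Fintype P] {n : ℕ} {g : P → Fin (n + 1)}
    (s : P) (hs : g s ≠ 0) : ∃ a ∈ minFib g, a ≤ s ∧ g a = g s := by
  induction s using WellFoundedLT.induction with
  | _ s ih =>
    by_cases h : s ∈ minFib g
    · exact ⟨s, h, le_rfl, rfl⟩
    · rw [mem_minFib] at h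
      push Not at h
      obtain ⟨t, ht, hg⟩ := h hs
      obtain ⟨a, ha, hat, hga⟩ := ih t ht (by rwa [hg])
      exact ⟨a, ha, hat.trans ht.le, hga.trans hg⟩

open Classical in
/-- The weakly order-preserving extension of a map that is defined on a subset. -/
noncomputable def supExtend {P : Type} [PartialOrder P] {n : ℕ} (A : Finset P)
    (φ : A → Set.Icc 1 n) (s : P) : Fin (n + 1) :=
  (Finset.univ.filter fun a : A => (a : P) ≤ s).sup fun a =>
    ⟨(φ a : ℕ), Nat.lt_succ_of_le (φ a).2.2⟩

section supExtend

variable {P : Type} [PartialOrder P] {n : ℕ} {A : Finset P} {φ : A → Set.Icc 1 n}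

theorem supExtend_mono : Monotone (supExtend A φ) := by
  intro s t h
  apply Finset.sup_mono
  intro a
  simp only [Finset.mem_filter, Finset.mem_univ, true_and]
  exact fun h' => h'.trans h

theorem le_supExtend (a : A) (s : P) (h : (a : P) ≤ s) : (φ a : ℕ) ≤ supExtend A φ s := by
  classical
  have := Finset.le_sup (f := fun a : A => (⟨(φ a : ℕ), Nat.lt_succ_of_le (φ a).2.2⟩ : Fin (n + 1)))
    (show a ∈ Finset.univ.filter fun a : A => (a : P) ≤ s by simpa using h)
  exact this

theorem supExtend_eq (s : P) : supExtend A φ s = 0 ∨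
    ∃ a : A, (a : P) ≤ s ∧ (supExtend A φ s : ℕ) = φ a := by
  classical
  rcases (Finset.univ.filter fun a : A => (a : P) ≤ s).eq_empty_or_nonempty with h | h
  · left
    -- The empty supremum is the bottom element 0: nothing in `A` lies below `s`.
    simp only [supExtend, h, Finset.sup_empty]
    rfl
  · right
    obtain ⟨a, ha, h⟩ := Finset.exists_mem_eq_sup _ h
      (fun a : A => (⟨(φ a : ℕ), Nat.lt_succ_of_le (φ a).2.2⟩ : Fin (n + 1)))
    exact ⟨a, by simpa using ha, congrArg Fin.val h⟩

theorem supExtend_apply (hφ : StrictMono φ) (a : A) : (supExtend A φ a : ℕ) = φ a := by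
  apply le_antisymm _ (le_supExtend a a le_rfl)
  rcases supExtend_eq (φ := φ) (a : P) with h | ⟨b, hb, h⟩
  · simp [h]
  · rw [h]
    exact hφ.monotone hb

/-- A nonzero value at `s` is attained at some `a ≤ s` in `A`, so a fiber-minimal `s` equals this
`a`. Conversely, strictness of `φ` keeps the value at an element of `A` from occurring below it. -/
theorem minFib_supExtend [Fintype P] (hφ : StrictMono φ) : minFib (supExtend A φ) = A := by
  ext s
  rw [mem_minFib]
  constructor
  · rintro ⟨h0, h⟩
    rcases supExtend_eq (φ := φ) s with h' | ⟨a, ha, h'⟩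
    · exact absurd h' h0
    · rcases ha.eq_or_lt with rfl | hlt
      · exact a.2
      · refine absurd ?_ (h _ hlt)
        apply Fin.ext
        rw [supExtend_apply hφ, h']
  · intro hs
    have h1 := supExtend_apply hφ ⟨s, hs⟩
    have h2 := (φ ⟨s, hs⟩).2.1
    refine ⟨fun h => ?_, fun t ht h => ?_⟩
    · rw [h] at h1
      simp at h1
      omega
    · rcases supExtend_eq (φ := φ) t with h' | ⟨a, ha, h'⟩
      · rw [← h, h'] at h1
        simp at h1
        omega
      · have h3 : φ a < φ ⟨s, hs⟩ := hφ (Subtype.coe_lt_coe.1 (lt_of_le_of_lt ha ht))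
        rw [h, h1] at h'
        have h4 : (φ a : ℕ) < φ ⟨s, hs⟩ := h3
        omega

end supExtend

/-- `supExtend` is a bijection whose inverse restricts `g` to `minFib g`: by `exists_mem_minFib`,
each nonzero value of `g` is already attained at a fiber-minimal element below. -/
theorem card_minFib_eq {P : Type} [PartialOrder P] [Fintype P] (n : ℕ) (A : Finset P) :
    Nat.card {g : {g : P → Fin (n + 1) // Monotone g} // minFib g.1 = A} =
      strictOrderPoly A n := by
  symm
  apply Nat.card_congr
  refine Equiv.ofBijective
    (fun φ => ⟨⟨supExtend A φ.1, supExtend_mono⟩, minFib_supExtend φ.2⟩) ⟨?_, ?_⟩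
  · rintro ⟨φ, hφ⟩ ⟨ψ, hψ⟩ h
    simp only [Subtype.mk.injEq] at h
    apply Subtype.ext
    funext a
    apply Subtype.ext
    rw [← supExtend_apply hφ, h, supExtend_apply hψ]
  · rintro ⟨⟨g, hg⟩, rfl⟩
    have hφ : ∀ a : minFib g, (g a : ℕ) ∈ Set.Icc 1 n := fun a =>
      ⟨Nat.one_le_iff_ne_zero.2 fun h => (mem_minFib.1 a.2).1 (Fin.ext h), Fin.is_le _⟩
    have hmono : StrictMono fun a : minFib g => (⟨g a, hφ a⟩ : Set.Icc 1 n) := by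
      intro a b hab
      exact lt_of_le_of_ne (hg (le_of_lt hab)) fun h =>
        (mem_minFib.1 b.2).2 a hab (Fin.ext (congrArg Subtype.val h))
    refine ⟨⟨_, hmono⟩, ?_⟩
    apply Subtype.ext
    apply Subtype.ext
    funext s
    change supExtend (minFib g) (fun a => (⟨g a, hφ a⟩ : Set.Icc 1 n)) s = g s
    apply le_antisymm
    · rcases supExtend_eq (φ := fun a : minFib g => (⟨g a, hφ a⟩ : Set.Icc 1 n)) s with h | ⟨a, ha, h⟩
      · rw [h]
        exact Fin.zero_le _
      · rw [Fin.ext h]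
        exact hg ha
    · by_cases h : g s = 0
      · simp [h]
      · obtain ⟨a, ha, has, h⟩ := exists_mem_minFib s h
        rw [← h]
        exact le_supExtend (φ := fun a : minFib g => (⟨g a, hφ a⟩ : Set.Icc 1 n)) ⟨a, ha⟩ s has

theorem card_minFib_card_eq {P : Type} [PartialOrder P] [Fintype P] (n k : ℕ) :
    Nat.card {g : {g : P → Fin (n + 1) // Monotone g} // (minFib g.1).card = k} =
      ∑ A ∈ (Finset.univ : Finset P).powersetCard k, strictOrderPoly A n := by
  classical
  have : Fintype {g : P → Fin (n + 1) // Monotone g} := Fintype.ofFinite _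
  simp only [← card_minFib_eq, Nat.card_eq_fintype_card, Fintype.card_subtype]
  rw [Finset.card_eq_sum_card_fiberwise (f := fun g => minFib g.1)
    (t := (Finset.univ : Finset P).powersetCard k)]
  · refine Finset.sum_congr rfl fun A hA => congrArg _ ?_
    ext g
    rw [Finset.mem_powersetCard_univ] at hA
    simp only [Finset.mem_filter, Finset.mem_univ, true_and, and_iff_right_iff_imp]
    rintro rfl
    exact hA
  · intro g hg
    simpa [Finset.mem_powersetCard_univ] using hg

/-! ### Coordinates -/

theorem hexLattice_adj {r c r' c' : ℤ} : hexLattice.Adj (r, c) (r', c') ↔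
    (r' = r ∧ (c' = c + 1 ∨ c = c' + 1)) ∨
      (c' = c ∧ ((r' = r + 1 ∧ (r + c) % 2 = 0) ∨ (r = r' + 1 ∧ (r' + c) % 2 = 0))) := by
  simp only [hexLattice, SimpleGraph.fromRel_adj, Int.even_iff, ne_eq, Prod.mk.injEq]
  omega

theorem mem_hexVerts {r c a b : ℤ} : (a, b) ∈ hexVerts (r, c) ↔
    (a = r ∨ a = r + 1) ∧ (b = c - 1 ∨ b = c ∨ b = c + 1) := Iff.rfl

/-! ### The strip in integer coordinates -/

namespace RegularStrip

variable {m n : ℕ} (S : RegularStrip m n)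

/-- The column of the leftmost vertical edge of a tier; there is a virtual tier above the first one
and one below the last one, both of length `n - 1`. -/
def left (k : ℤ) : ℤ :=
  if h : 0 ≤ k ∧ k < m then S.first ⟨k.toNat, by omega⟩
  else if k < 0 then S.first ⟨0, S.tiers_pos⟩ + 1
  else S.first ⟨m - 1, Nat.sub_lt S.tiers_pos one_pos⟩ + 1

/-- The column of the rightmost vertical edge of a tier, with the two virtual tiers of `left`. -/
def right (k : ℤ) : ℤ :=
  if h : 0 ≤ k ∧ k < m then S.first ⟨k.toNat, by omega⟩ + 2 * S.len ⟨k.toNat, by omega⟩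
  else if k < 0 then S.first ⟨0, S.tiers_pos⟩ + 2 * n - 1
  else S.first ⟨m - 1, Nat.sub_lt S.tiers_pos one_pos⟩ + 2 * n - 1

theorem left_coe (k : Fin m) : S.left ((k : ℕ) : ℤ) = S.first k := by
  have := k.2
  rw [left, dif_pos (by omega)]
  rfl

theorem right_coe (k : Fin m) : S.right ((k : ℕ) : ℤ) = S.first k + 2 * S.len k := by
  have := k.2
  rw [right, dif_pos (by omega)]
  rfl

theorem n_pos (S : RegularStrip m n) : 0 < n := by
  rw [← S.len_top ⟨0, S.tiers_pos⟩ rfl]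
  exact S.len_pos _

/-- With the virtual tiers inset by half a hexagon at both ends, the first and last zigzag lines
obey the same step rules as the inner ones and gain no vertices. -/
theorem left_neg_one : S.left (-1) = S.left 0 + 1 := by
  rw [show (0 : ℤ) = (((⟨0, S.tiers_pos⟩ : Fin m) : ℕ) : ℤ) from rfl, left_coe, left,
    dif_neg (by omega), if_pos (by omega)]

theorem right_neg_one : S.right (-1) = S.right 0 - 1 := by
  rw [show (0 : ℤ) = (((⟨0, S.tiers_pos⟩ : Fin m) : ℕ) : ℤ) from rfl, right_coe, right,
    dif_neg (by omega), if_pos (by omega), S.len_top _ rfl]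

theorem right_zero : S.right 0 = S.left 0 + 2 * n := by
  rw [show (0 : ℤ) = (((⟨0, S.tiers_pos⟩ : Fin m) : ℕ) : ℤ) from rfl, right_coe, left_coe,
    S.len_top _ rfl]

theorem cast_pred_m : ((m : ℤ) - 1) =
    (((⟨m - 1, Nat.sub_lt S.tiers_pos one_pos⟩ : Fin m) : ℕ) : ℤ) := by
  have := S.tiers_pos
  simp only
  omega

theorem left_m : S.left m = S.left (m - 1) + 1 := by
  rw [S.cast_pred_m, left_coe, left, dif_neg (by omega), if_neg (by omega)]

theorem right_m : S.right m = S.right (m - 1) - 1 := by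
  have := S.tiers_pos
  rw [S.cast_pred_m, right_coe, right, dif_neg (by omega), if_neg (by omega),
    S.len_bottom _ (by simp only; omega)]

theorem right_pred_m : S.right (m - 1) = S.left (m - 1) + 2 * n := by
  have := S.tiers_pos
  rw [S.cast_pred_m, right_coe, left_coe, S.len_bottom _ (by simp only; omega)]

theorem exists_tier {k : ℤ} (h0 : 0 ≤ k) (hm : k < m) : ∃ i : Fin m, ((i : ℕ) : ℤ) = k :=
  ⟨⟨k.toNat, by omega⟩, by simp only; omega⟩

theorem left_lt_right {k : ℤ} (h0 : 0 ≤ k) (hm : k < m) : S.left k + 2 ≤ S.right k := by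
  obtain ⟨i, rfl⟩ := exists_tier h0 hm
  rw [left_coe, right_coe]
  have := S.len_pos i
  omega

theorem left_succ {k : ℤ} (h0 : -1 ≤ k) (hm : k < m) :
    S.left (k + 1) = S.left k + 1 ∨ S.left (k + 1) = S.left k - 1 := by
  have := S.tiers_pos
  rcases eq_or_lt_of_le h0 with rfl | h0
  · right
    rw [left_neg_one]
    simp
  rcases eq_or_lt_of_le (show k ≤ (m : ℤ) - 1 by omega) with rfl | hm'
  · left
    rw [sub_add_cancel, left_m]
  obtain ⟨i, rfl⟩ := exists_tier (show 0 ≤ k by omega) hm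
  obtain ⟨j, hj⟩ := exists_tier (m := m) (show 0 ≤ ((i : ℕ) : ℤ) + 1 by omega) (by omega)
  rw [← hj, left_coe, left_coe]
  have := S.left_step i j (by omega)
  rw [abs_eq (by norm_num)] at this
  omega

theorem right_succ {k : ℤ} (h0 : -1 ≤ k) (hm : k < m) :
    S.right (k + 1) = S.right k + 1 ∨ S.right (k + 1) = S.right k - 1 := by
  have := S.tiers_pos
  rcases eq_or_lt_of_le h0 with rfl | h0
  · left
    rw [right_neg_one]
    simp
  rcases eq_or_lt_of_le (show k ≤ (m : ℤ) - 1 by omega) with rfl | hm'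
  · right
    rw [sub_add_cancel, right_m]
  obtain ⟨i, rfl⟩ := exists_tier (show 0 ≤ k by omega) hm
  obtain ⟨j, hj⟩ := exists_tier (m := m) (show 0 ≤ ((i : ℕ) : ℤ) + 1 by omega) (by omega)
  rw [← hj, right_coe, right_coe]
  have := S.right_step i j (by omega)
  rw [abs_eq (by norm_num)] at this
  omega

theorem left_mod_two {k : ℤ} (h0 : -1 ≤ k) (hm : k ≤ m) : (k + S.left k) % 2 = 0 := by
  have h : ∀ k : ℤ, 0 ≤ k → k < m → (k + S.left k) % 2 = 0 := by
    intro k h0 hm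
    obtain ⟨i, rfl⟩ := exists_tier h0 hm
    rw [left_coe]
    exact Int.even_iff.1 (S.even_first i)
  have := S.tiers_pos
  rcases eq_or_lt_of_le h0 with rfl | h0
  · have := h 0 le_rfl (by omega)
    rw [left_neg_one]
    omega
  rcases eq_or_lt_of_le hm with rfl | hm
  · have := h (m - 1) (by omega) (by omega)
    rw [left_m]
    omega
  exact h k (by omega) hm

theorem right_mod_two {k : ℤ} (h0 : -1 ≤ k) (hm : k ≤ m) : (k + S.right k) % 2 = 0 := by
  have h : ∀ k : ℤ, 0 ≤ k → k < m → (k + S.right k) % 2 = 0 := by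
    intro k h0 hm
    have := S.left_mod_two (show -1 ≤ k by omega) hm.le
    obtain ⟨i, rfl⟩ := exists_tier h0 hm
    rw [left_coe] at this
    rw [right_coe]
    omega
  have := S.tiers_pos
  rcases eq_or_lt_of_le h0 with rfl | h0
  · have := h 0 le_rfl (by omega)
    rw [right_neg_one]
    omega
  rcases eq_or_lt_of_le hm with rfl | hm
  · have := h (m - 1) (by omega) (by omega)
    rw [right_m]
    omega
  exact h k (by omega) hm

theorem mem_hexagons {r c : ℤ} : (r, c) ∈ S.hexagons ↔
    (0 ≤ r ∧ r < m) ∧ S.left r < c ∧ c < S.right r ∧ (r + c) % 2 = 1 := by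
  constructor
  · rintro ⟨k, j, hj, h⟩
    obtain ⟨rfl, rfl⟩ := Prod.mk.inj h
    have := S.left_mod_two (k := k) (by omega) (by omega)
    have := k.2
    rw [left_coe] at *
    rw [right_coe]
    omega
  · rintro ⟨⟨h0, hm⟩, hl, hr, h2⟩
    have := S.left_mod_two (k := r) (by omega) (by omega)
    obtain ⟨k, rfl⟩ := exists_tier h0 hm
    rw [left_coe] at *
    rw [right_coe] at *
    refine ⟨k, ((c - S.first k - 1) / 2).toNat, ?_, Prod.ext rfl ?_⟩
    · omega
    · simp only
      omega

/-- The spans of the two tiers at a line leave no gap between them, so the left and the right bound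
may come from different tiers. -/
theorem mem_verts {r c : ℤ} : (r, c) ∈ S.graph.verts ↔ (0 ≤ r ∧ r ≤ m) ∧
    (S.left (r - 1) ≤ c ∨ S.left r ≤ c) ∧ (c ≤ S.right (r - 1) ∨ c ≤ S.right r) := by
  have hm := S.tiers_pos
  constructor
  · rintro ⟨⟨a, b⟩, hh, hv⟩
    rw [mem_hexagons] at hh
    rw [mem_hexVerts] at hv
    rcases hv with ⟨rfl | rfl, hv⟩
    · omega
    · rw [add_sub_cancel_right]
      omega
  · rintro ⟨⟨h0, hm⟩, hl, hr⟩
    have key : ∀ k : ℤ, 0 ≤ k → k < m → (r = k ∨ r = k + 1) → S.left k ≤ c → c ≤ S.right k →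
        (r, c) ∈ S.graph.verts := by
      intro k h0 hm hrk hl hr
      have h1 := S.left_mod_two (k := k) (by omega) (by omega)
      have h2 := S.right_mod_two (k := k) (by omega) (by omega)
      have h3 := S.left_lt_right h0 hm
      rcases Int.emod_two_eq_zero_or_one (k + c) with h | h
      · rcases eq_or_lt_of_le hl with hl | hl
        · exact ⟨(k, c + 1), S.mem_hexagons.2 (by omega), mem_hexVerts.2 (by omega)⟩
        · exact ⟨(k, c - 1), S.mem_hexagons.2 (by omega), mem_hexVerts.2 (by omega)⟩
      · exact ⟨(k, c), S.mem_hexagons.2 (by omega), mem_hexVerts.2 (by omega)⟩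
    have e1 := S.left_succ (k := r - 1) (by omega) (by omega)
    have e2 := S.right_succ (k := r - 1) (by omega) (by omega)
    rw [sub_add_cancel] at e1 e2
    by_cases ha : 0 ≤ r - 1 ∧ S.left (r - 1) ≤ c ∧ c ≤ S.right (r - 1)
    · exact key (r - 1) ha.1 (by omega) (by omega) ha.2.1 ha.2.2
    by_cases hb : r < m ∧ S.left r ≤ c ∧ c ≤ S.right r
    · exact key r h0 hb.1 (by omega) hb.2.1 hb.2.2
    exfalso
    rcases eq_or_lt_of_le h0 with rfl | h0
    · have := S.left_neg_one
      have := S.right_neg_one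
      rw [zero_sub] at *
      omega
    rcases eq_or_lt_of_le hm with rfl | hm
    · have := S.left_m
      have := S.right_m
      omega
    have := S.left_lt_right (k := r) (by omega) (by omega)
    have := S.left_lt_right (k := r - 1) (by omega) (by omega)
    have := S.left_mod_two (k := r) (by omega) (by omega)
    have := S.right_mod_two (k := r) (by omega) (by omega)
    omega

theorem adj_horizontal {r c : ℤ} : S.graph.Adj (r, c) (r, c + 1) ↔
    (r, c) ∈ S.graph.verts ∧ (r, c + 1) ∈ S.graph.verts := by
  refine ⟨fun h => ⟨h.fst_mem, h.snd_mem⟩, fun ⟨hu, hv⟩ => ⟨hexLattice_adj.2 (by omega), ?_⟩⟩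
  rw [mem_verts] at hu hv
  have key : ∀ k : ℤ, 0 ≤ k → k < m → (r = k ∨ r = k + 1) → S.left k ≤ c → c + 1 ≤ S.right k →
      ∃ h ∈ S.hexagons, (r, c) ∈ hexVerts h ∧ (r, c + 1) ∈ hexVerts h := by
    intro k h0 hm hrk hl hr
    have h1 := S.left_mod_two (k := k) (by omega) (by omega)
    have h2 := S.right_mod_two (k := k) (by omega) (by omega)
    rcases Int.emod_two_eq_zero_or_one (k + c) with h | h
    · exact ⟨(k, c + 1), S.mem_hexagons.2 (by omega), mem_hexVerts.2 (by omega),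
        mem_hexVerts.2 (by omega)⟩
    · exact ⟨(k, c), S.mem_hexagons.2 (by omega), mem_hexVerts.2 (by omega),
        mem_hexVerts.2 (by omega)⟩
  have e1 := S.left_succ (k := r - 1) (by omega) (by omega)
  have e2 := S.right_succ (k := r - 1) (by omega) (by omega)
  rw [sub_add_cancel] at e1 e2
  by_cases ha : 0 ≤ r - 1 ∧ S.left (r - 1) ≤ c ∧ c + 1 ≤ S.right (r - 1)
  · exact key (r - 1) ha.1 (by omega) (by omega) ha.2.1 ha.2.2
  by_cases hb : r < m ∧ S.left r ≤ c ∧ c + 1 ≤ S.right r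
  · exact key r (by omega) hb.1 (by omega) hb.2.1 hb.2.2
  exfalso
  rcases eq_or_lt_of_le hu.1.1 with rfl | h0
  · have := S.left_neg_one
    have := S.right_neg_one
    have := S.tiers_pos
    rw [zero_sub] at *
    omega
  rcases eq_or_lt_of_le hu.1.2 with rfl | hm
  · have := S.left_m
    have := S.right_m
    omega
  have := S.left_lt_right (k := r) (by omega) (by omega)
  have := S.left_lt_right (k := r - 1) (by omega) (by omega)
  omega

theorem adj_vertical {r c : ℤ} : S.graph.Adj (r, c) (r + 1, c) ↔
    (0 ≤ r ∧ r < m) ∧ S.left r ≤ c ∧ c ≤ S.right r ∧ (r + c) % 2 = 0 := by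
  constructor
  · rintro ⟨h, ⟨a, b⟩, hh, hu, hv⟩
    rw [hexLattice_adj] at h
    rw [mem_hexagons] at hh
    rw [mem_hexVerts] at hu hv
    obtain rfl : a = r := by omega
    omega
  · rintro ⟨h, hl, hr, h2⟩
    have h3 := S.left_lt_right h.1 h.2
    have h1 := S.left_mod_two (k := r) (by omega) (by omega)
    have h4 := S.right_mod_two (k := r) (by omega) (by omega)
    refine ⟨hexLattice_adj.2 (by omega), ?_⟩
    rcases eq_or_lt_of_le hl with hl | hl
    · exact ⟨(r, c + 1), S.mem_hexagons.2 (by omega), mem_hexVerts.2 (by omega),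
        mem_hexVerts.2 (by omega)⟩
    · exact ⟨(r, c - 1), S.mem_hexagons.2 (by omega), mem_hexVerts.2 (by omega),
        mem_hexVerts.2 (by omega)⟩

end RegularStrip

/-! ### Matchings in coordinates -/

open Classical in
/-- The indicator of a proposition, as an integer. -/
noncomputable def ind (p : Prop) : ℤ := if p then 1 else 0

theorem ind_cases (p : Prop) : (p ∧ ind p = 1) ∨ (¬ p ∧ ind p = 0) := by
  by_cases h : p <;> simp [ind, h]

theorem ind_eq_zero_or_one (p : Prop) : ind p = 0 ∨ ind p = 1 := by
  by_cases h : p <;> simp [ind, h]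

theorem of_ind_eq_one {p : Prop} (h : ind p = 1) : p := by
  rcases ind_cases p with h' | h' <;> [exact h'.1; omega]

theorem ind_of_not {p : Prop} (h : ¬ p) : ind p = 0 := if_neg h

theorem ind_of {p : Prop} (h : p) : ind p = 1 := if_pos h

theorem subgraph_adj_iff (K : hexLattice.Subgraph) {r c : ℤ} {w : ℤ × ℤ} : K.Adj (r, c) w ↔
    (w = (r, c + 1) ∧ K.Adj (r, c) (r, c + 1)) ∨ (w = (r, c - 1) ∧ K.Adj (r, c - 1) (r, c - 1 + 1)) ∨
    (w = (r + 1, c) ∧ K.Adj (r, c) (r + 1, c)) ∨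
      (w = (r - 1, c) ∧ K.Adj (r - 1, c) (r - 1 + 1, c)) := by
  simp only [sub_add_cancel]
  constructor
  · intro h
    obtain ⟨a, b⟩ := w
    have := K.adj_sub h
    rw [hexLattice_adj] at this
    rcases this with ⟨rfl, rfl | rfl⟩ | ⟨rfl, ⟨rfl, -⟩ | ⟨rfl, -⟩⟩
    · exact Or.inl ⟨rfl, h⟩
    · rw [add_sub_cancel_right]
      exact Or.inr (Or.inl ⟨rfl, h.symm⟩)
    · exact Or.inr (Or.inr (Or.inl ⟨rfl, h⟩))
    · rw [add_sub_cancel_right]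
      exact Or.inr (Or.inr (Or.inr ⟨rfl, h.symm⟩))
  · rintro (⟨rfl, h⟩ | ⟨rfl, h⟩ | ⟨rfl, h⟩ | ⟨rfl, h⟩)
    exacts [h, h.symm, h, h.symm]

theorem subgraph_ext {K K' : hexLattice.Subgraph} (hv : K.verts = K'.verts)
    (h1 : ∀ r c, K.Adj (r, c) (r, c + 1) ↔ K'.Adj (r, c) (r, c + 1))
    (h2 : ∀ r c, K.Adj (r, c) (r + 1, c) ↔ K'.Adj (r, c) (r + 1, c)) : K = K' := by
  apply SimpleGraph.Subgraph.ext hv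
  funext ⟨r, c⟩ w
  exact propext ((subgraph_adj_iff K).trans
    ((by simp only [h1, h2] : _ ↔ _).trans (subgraph_adj_iff K').symm))

/-- Turns the matching condition into linear arithmetic. Each bond is named by its left or upper
end; a vertical bond that the lattice lacks contributes 0, so no parity cases are needed. -/
theorem existsUnique_adj_iff (K : hexLattice.Subgraph) (r c : ℤ) :
    (∃! w, K.Adj (r, c) w) ↔
      ind (K.Adj (r, c - 1) (r, c - 1 + 1)) + ind (K.Adj (r, c) (r, c + 1)) +
        ind (K.Adj (r, c) (r + 1, c)) + ind (K.Adj (r - 1, c) (r - 1 + 1, c)) = 1 := by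
  have i1 := ind_cases (K.Adj (r, c - 1) (r, c - 1 + 1))
  have i2 := ind_cases (K.Adj (r, c) (r, c + 1))
  have i3 := ind_cases (K.Adj (r, c) (r + 1, c))
  have i4 := ind_cases (K.Adj (r - 1, c) (r - 1 + 1, c))
  have hadj := fun w => subgraph_adj_iff K (r := r) (c := c) (w := w)
  constructor
  · rintro ⟨⟨a, b⟩, hw, hu⟩
    have h1 := fun h => hu (r, c - 1) ((hadj _).2 (Or.inr (Or.inl ⟨rfl, of_ind_eq_one h⟩)))
    have h2 := fun h => hu (r, c + 1) ((hadj _).2 (Or.inl ⟨rfl, of_ind_eq_one h⟩))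
    have h3 := fun h => hu (r + 1, c)
      ((hadj _).2 (Or.inr (Or.inr (Or.inl ⟨rfl, of_ind_eq_one h⟩))))
    have h4 := fun h => hu (r - 1, c)
      ((hadj _).2 (Or.inr (Or.inr (Or.inr ⟨rfl, of_ind_eq_one h⟩))))
    simp only [Prod.mk.injEq] at h1 h2 h3 h4
    rcases (hadj _).1 hw with ⟨-, h⟩ | ⟨-, h⟩ | ⟨-, h⟩ | ⟨-, h⟩ <;> have := ind_of h <;> omega
  · intro h
    rcases i1 with ⟨j1, k1⟩ | ⟨j1, k1⟩ <;> rcases i2 with ⟨j2, k2⟩ | ⟨j2, k2⟩ <;>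
      rcases i3 with ⟨j3, k3⟩ | ⟨j3, k3⟩ <;> rcases i4 with ⟨j4, k4⟩ | ⟨j4, k4⟩ <;>
      first
        | (exfalso; omega)
        | refine ⟨_, (hadj (r, c + 1)).2 (Or.inl ⟨rfl, j2⟩), fun y hy => ?_⟩
        | refine ⟨_, (hadj (r, c - 1)).2 (Or.inr (Or.inl ⟨rfl, j1⟩)), fun y hy => ?_⟩
        | refine ⟨_, (hadj (r + 1, c)).2 (Or.inr (Or.inr (Or.inl ⟨rfl, j3⟩))), fun y hy => ?_⟩
        | refine ⟨_, (hadj (r - 1, c)).2 (Or.inr (Or.inr (Or.inr ⟨rfl, j4⟩))), fun y hy => ?_⟩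
    all_goals
      rcases (hadj y).1 hy with h | h | h | h <;> first | exact h.1 | exact absurd h.2 (by assumption)

/-- If the vertices of a path are alternately incident with edges counted by `A` and by `B`, and
each of them lies on exactly one chosen edge, then `A - B` is determined by the path edges. -/
theorem alternating_count {A B a b e : ℤ → ℤ} {L R : ℤ} (hA : ∀ c, A c = A (c - 1) + a c)
    (hB : ∀ c, B c = B (c - 1) + b c) (hA0 : A (L - 1) = 0) (hB0 : B (L - 1) = 0)
    (he0 : e (L - 1) = 0) (hab : ∀ c, (c - L) % 2 = 0 → b c = 0)
    (hba : ∀ c, (c - L) % 2 = 1 → a c = 0)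
    (h : ∀ c, L ≤ c → c ≤ R → e (c - 1) + e c + a c + b c = 1) (c : ℤ) (hL : L - 1 ≤ c)
    (hR : c ≤ R) : ((c - L) % 2 = 0 → A c - B c = 1 - e c) ∧ ((c - L) % 2 = 1 → A c - B c = e c) := by
  induction c, hL using Int.leInduction with
  | base => omega
  | succ c hc ih =>
    have ih := ih (by omega)
    have h1 := hA (c + 1)
    have h2 := hB (c + 1)
    have h3 := hab (c + 1)
    have h4 := hba (c + 1)
    have h5 := h (c + 1) (by omega) hR
    rw [add_sub_cancel_right] at h1 h2 h5
    omega

/-! ### Kekulé structures as bond sets with a local law -/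

namespace RegularStrip

variable {m n : ℕ} (S : RegularStrip m n)

/-- The conditions on sets `e` of horizontal and `V` of vertical bonds, given by their left and upper
ends, to form a Kekulé structure of the strip. -/
structure IsConfig (e V : ℤ → ℤ → Prop) : Prop where
  vert_mem : ∀ {k c}, V k c → (0 ≤ k ∧ k < m) ∧ S.left k ≤ c ∧ c ≤ S.right k ∧ (k + c) % 2 = 0
  hor_mem : ∀ {r c}, e r c → (r, c) ∈ S.graph.verts ∧ (r, c + 1) ∈ S.graph.verts
  law : ∀ {r c}, (r, c) ∈ S.graph.verts →
    ind (e r (c - 1)) + ind (e r c) + ind (V r c) + ind (V (r - 1) c) = 1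

theorem isConfig_of_isKekule {K : hexLattice.Subgraph} (hK : IsKekule S.graph K) :
    S.IsConfig (fun r c => K.Adj (r, c) (r, c + 1)) (fun r c => K.Adj (r, c) (r + 1, c)) where
  vert_mem h := S.adj_vertical.1 (hK.1.2 h)
  hor_mem h := S.adj_horizontal.1 (hK.1.2 h)
  law h := (existsUnique_adj_iff K _ _).1 (hK.2.2 (hK.2.1 ▸ h))

/-- The subgraph of the strip with the given horizontal and vertical bonds. -/
def ofBonds (e V : ℤ → ℤ → Prop) : hexLattice.Subgraph where
  verts := S.graph.verts
  Adj u v := S.graph.Adj u v ∧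
    ((u.1 = v.1 ∧ v.2 = u.2 + 1 ∧ e u.1 u.2) ∨ (u.1 = v.1 ∧ u.2 = v.2 + 1 ∧ e v.1 v.2) ∨
      (v.1 = u.1 + 1 ∧ v.2 = u.2 ∧ V u.1 u.2) ∨ (u.1 = v.1 + 1 ∧ u.2 = v.2 ∧ V v.1 v.2))
  adj_sub h := S.graph.adj_sub h.1
  edge_vert h := S.graph.edge_vert h.1
  symm := ⟨fun _ _ ⟨h, h'⟩ => ⟨h.symm, by
    rcases h' with ⟨h1, h2, h3⟩ | ⟨h1, h2, h3⟩ | ⟨h1, h2, h3⟩ | ⟨h1, h2, h3⟩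
    · exact Or.inr (Or.inl ⟨h1.symm, h2, h3⟩)
    · exact Or.inl ⟨h1.symm, h2, h3⟩
    · exact Or.inr (Or.inr (Or.inr ⟨h1, h2, h3⟩))
    · exact Or.inr (Or.inr (Or.inl ⟨h1, h2, h3⟩))⟩⟩

variable {S} {e V : ℤ → ℤ → Prop}

theorem IsConfig.ofBonds_horizontal (h : S.IsConfig e V) {r c : ℤ} :
    (S.ofBonds e V).Adj (r, c) (r, c + 1) ↔ e r c := by
  constructor
  · rintro ⟨-, h | h | h | h⟩ <;> simp only at h
    · exact h.2.2
    all_goals omega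
  · intro he
    exact ⟨S.adj_horizontal.2 (h.hor_mem he), Or.inl ⟨rfl, rfl, he⟩⟩

theorem IsConfig.ofBonds_vertical (h : S.IsConfig e V) {r c : ℤ} :
    (S.ofBonds e V).Adj (r, c) (r + 1, c) ↔ V r c := by
  constructor
  · rintro ⟨-, h | h | h | h⟩ <;> simp only at h
    · omega
    · omega
    · exact h.2.2
    · omega
  · intro hV
    exact ⟨S.adj_vertical.2 (h.vert_mem hV), Or.inr (Or.inr (Or.inl ⟨rfl, rfl, hV⟩))⟩

theorem IsConfig.isKekule (h : S.IsConfig e V) : IsKekule S.graph (S.ofBonds e V) := by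
  refine ⟨⟨le_rfl, fun _ _ h => h.1⟩, rfl, ?_⟩
  rintro ⟨r, c⟩ hv
  rw [existsUnique_adj_iff]
  simp only [h.ofBonds_horizontal, h.ofBonds_vertical]
  exact h.law hv

/-! ### Counting vertical bonds along a zigzag line -/

variable (S)

/-- Of the two tiers adjacent to a zigzag line, the one that begins further left. -/
def outer (r : ℤ) : ℤ := if S.left (r - 1) < S.left r then r - 1 else r

/-- Of the two tiers adjacent to a zigzag line, the one that begins further right. -/
def inner (r : ℤ) : ℤ := if S.left (r - 1) < S.left r then r else r - 1

theorem outer_inner {r : ℤ} (h0 : 0 ≤ r) (hm : r ≤ m) :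
    ((S.outer r = r - 1 ∧ S.inner r = r) ∨ (S.outer r = r ∧ S.inner r = r - 1)) ∧
    S.left (S.inner r) = S.left (S.outer r) + 1 ∧
    (S.right (S.inner r) = S.right (S.outer r) + 1 ∨
      S.right (S.inner r) = S.right (S.outer r) - 1) ∧
    (r - 1 + S.left (r - 1)) % 2 = 0 ∧ (r + S.left r) % 2 = 0 ∧
    (r - 1 + S.right (r - 1)) % 2 = 0 ∧ (r + S.right r) % 2 = 0 := by
  have h1 := S.left_succ (k := r - 1) (by omega) (by omega)
  have h2 := S.right_succ (k := r - 1) (by omega) (by omega)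
  have h3 := S.left_mod_two (k := r - 1) (by omega) (by omega)
  have h4 := S.left_mod_two (k := r) (by omega) (by omega)
  have h5 := S.right_mod_two (k := r - 1) (by omega) (by omega)
  have h6 := S.right_mod_two (k := r) (by omega) (by omega)
  rw [sub_add_cancel] at h1 h2
  unfold outer inner
  split_ifs <;> omega

theorem mem_verts_iff_outer {r c : ℤ} (h0 : 0 ≤ r) (hm : r ≤ m) : (r, c) ∈ S.graph.verts ↔
    S.left (S.outer r) ≤ c ∧ (c ≤ S.right (S.outer r) ∨ c ≤ S.right (S.inner r)) := by
  rw [mem_verts]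
  rcases S.outer_inner h0 hm with ⟨⟨h1, h2⟩ | ⟨h1, h2⟩, h, -⟩ <;> rw [h1, h2] at * <;> omega

/-- The order `|i_k| - n` of an interface, as an integer, for the tiers of `left`. -/
def order (k : ℤ) : ℤ := (S.right k - S.left k) / 2 + 1 - n

open Classical in
/-- The number of bonds of a set `V` of vertical bonds in tier `k` up to the column `c`. -/
noncomputable def tally (V : ℤ → ℤ → Prop) (k c : ℤ) : ℤ :=
  ((Finset.Icc (S.left k) c).filter (V k)).card

variable {S}

theorem tally_eq_zero {k c : ℤ} (h : c < S.left k) : S.tally V k c = 0 := by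
  rw [tally, Finset.Icc_eq_empty (by omega)]
  rfl

theorem tally_succ (hV : ∀ k c, V k c → S.left k ≤ c) (k c : ℤ) :
    S.tally V k c = S.tally V k (c - 1) + ind (V k c) := by
  classical
  rcases lt_or_ge c (S.left k) with h | h
  · rw [tally_eq_zero h, tally_eq_zero (by omega)]
    rw [ind_of_not fun h' => by have := hV _ _ h'; omega, add_zero]
  · have : Finset.Icc (S.left k) c = insert c (Finset.Icc (S.left k) (c - 1)) := by
      ext x
      simp only [Finset.mem_insert, Finset.mem_Icc]
      omega
    rw [tally, tally, this, Finset.filter_insert]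
    by_cases hc : V k c
    · rw [if_pos hc, Finset.card_insert_of_notMem (by simp), ind, if_pos hc]
      push_cast
      rfl
    · rw [if_neg hc, ind, if_neg hc, add_zero]

theorem tally_eq_of_right_le {k : ℤ} (hV : ∀ k c, V k c → S.left k ≤ c ∧ c ≤ S.right k) {c : ℤ}
    (hc : S.right k ≤ c) : S.tally V k c = S.tally V k (S.right k) := by
  induction c, hc using Int.leInduction with
  | base => rfl
  | succ c hc ih =>
    rw [tally_succ (fun k c h => (hV k c h).1), add_sub_cancel_right, ih]
    rw [ind_of_not fun h' => by have := hV _ _ h'; omega, add_zero]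

/-- The leftmost vertex of the line belongs to the outer tier, and from there vertices at even
offset can carry vertical bonds of the outer tier only, those at odd offset of the inner tier only.
So `alternating_count` applies; in particular the two tallies differ by 0 or 1. -/
theorem IsConfig.tally_sub (h : S.IsConfig e V) {r : ℤ} (h0 : 0 ≤ r) (hm : r ≤ m) {c : ℤ}
    (hL : S.left (S.outer r) - 1 ≤ c)
    (hR : c ≤ S.right (S.outer r) ∨ c ≤ S.right (S.inner r)) :
    ((c - S.left (S.outer r)) % 2 = 0 →
      S.tally V (S.outer r) c - S.tally V (S.inner r) c = 1 - ind (e r c)) ∧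
    ((c - S.left (S.outer r)) % 2 = 1 →
      S.tally V (S.outer r) c - S.tally V (S.inner r) c = ind (e r c)) := by
  have hoi := S.outer_inner h0 hm
  have hpar : ∀ k c, ind (V k c) = 1 → (k + c) % 2 = 0 := fun k c hi =>
    (h.vert_mem (of_ind_eq_one hi)).2.2.2
  have hz : ∀ k c, ind (V k c) = 0 ∨ ind (V k c) = 1 := fun k c => ind_eq_zero_or_one _
  have hA := fun k c => tally_succ (S := S) (V := V) (fun _ _ h' => (h.vert_mem h').2.1) k c
  have hmem := fun c => S.mem_verts_iff_outer h0 hm (c := c)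
  generalize S.outer r = o at *
  generalize S.inner r = i at *
  refine alternating_count (e := fun c => ind (e r c)) (R := max (S.right o) (S.right i))
    (hA o) (hA i) (tally_eq_zero (by omega)) (tally_eq_zero (by omega)) ?_ ?_ ?_ ?_ c hL (by omega)
  · apply ind_of_not
    intro h'
    have := (hmem _).1 (h.hor_mem h').1
    omega
  · intro c hc
    have h1 := hz i c
    have h2 := hpar i c
    rcases hoi with ⟨⟨rfl, rfl⟩ | ⟨rfl, rfl⟩, h⟩ <;> omega
  · intro c hc
    have h1 := hz o c
    have h2 := hpar o c
    rcases hoi with ⟨⟨rfl, rfl⟩ | ⟨rfl, rfl⟩, h⟩ <;> omega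
  · intro c hL hR
    have := h.law ((hmem c).2 (by omega))
    rcases hoi with ⟨⟨rfl, rfl⟩ | ⟨rfl, rfl⟩, h⟩ <;> omega

/-- Induction downwards from the virtual tier `-1`, where both sides are 0; crossing a zigzag line
changes both sides equally. -/
theorem IsConfig.tally_eq_order (h : S.IsConfig e V) {k : ℤ} (h0 : -1 ≤ k) (hm : k ≤ m) :
    S.tally V k (S.right k) = S.order k := by
  induction k, h0 using Int.leInduction with
  | base =>
    have hc : ∀ c, ¬ V (-1) c := fun c hc => by
      have := h.vert_mem hc
      omega
    have : S.order (-1) = 0 := by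
      rw [order, right_neg_one, left_neg_one, right_zero]
      omega
    rw [this]
    simp [tally, hc]
  | succ k hk ih =>
    have ih := ih (by omega)
    have hoi := S.outer_inner (r := k + 1) (by omega) hm
    have hmem := fun c => S.mem_verts_iff_outer (show 0 ≤ k + 1 by omega) hm (c := c)
    have hsub := fun c => h.tally_sub (r := k + 1) (by omega) hm (c := c)
    have hV : ∀ k c, V k c → S.left k ≤ c ∧ c ≤ S.right k := fun _ _ h' =>
      ⟨(h.vert_mem h').2.1, (h.vert_mem h').2.2.1⟩
    have hlr : S.left k ≤ S.right k ∧ S.left (k + 1) - 1 ≤ S.right (k + 1) := by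
      have := S.left_lt_right (k := k)
      have := S.left_lt_right (k := k + 1)
      have := S.n_pos
      rcases eq_or_lt_of_le hk with rfl | hk
      · rw [right_neg_one, left_neg_one, right_zero, neg_add_cancel, right_zero]
        omega
      · rcases eq_or_lt_of_le hm with hm | hm
        · obtain rfl : k = m - 1 := by omega
          rw [sub_add_cancel, right_m, left_m, right_pred_m]
          omega
        · omega
    rw [add_sub_cancel_right] at hoi
    generalize S.outer (k + 1) = o at *
    generalize S.inner (k + 1) = i at *
    -- No bond leads beyond the right end of the line, so the parity of that end alone fixes the
    -- difference of the totals.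
    have hn : ind (e (k + 1) (max (S.right o) (S.right i))) = 0 := by
      apply ind_of_not
      intro he
      have := (hmem _).1 (h.hor_mem he).2
      omega
    have hto := tally_eq_of_right_le hV (le_max_left (S.right o) (S.right i))
    have hti := tally_eq_of_right_le hV (le_max_right (S.right o) (S.right i))
    have h1 := hsub (max (S.right o) (S.right i))
      (by rcases hoi with ⟨⟨rfl, rfl⟩ | ⟨rfl, rfl⟩, h⟩ <;> omega) (by omega)
    rw [hto, hti, hn] at h1
    unfold order at *
    rcases le_total (S.right o) (S.right i) with hle | hle
    · rw [max_eq_right hle] at h1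
      rcases hoi with ⟨⟨rfl, rfl⟩ | ⟨rfl, rfl⟩, h⟩ <;> omega
    · rw [max_eq_left hle] at h1
      rcases hoi with ⟨⟨rfl, rfl⟩ | ⟨rfl, rfl⟩, h⟩ <;> omega

theorem ncard_interface (S : RegularStrip m n) (k : Fin m) : (S.interface k).ncard = S.len k + 1 := by
  have : S.interface k = (fun j : ℕ => s((((k : ℕ) : ℤ), S.first k + 2 * (j : ℤ)),
      (((k : ℕ) : ℤ) + 1, S.first k + 2 * (j : ℤ)))) '' (Finset.range (S.len k + 1)) := by
    ext e
    rw [mem_interface]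
    simp only [Set.mem_image, Finset.coe_range, Set.mem_Iio, Nat.lt_succ_iff, eq_comm]
  rw [this, Set.ncard_image_of_injective, Set.ncard_coe_finset, Finset.card_range]
  intro i j h
  simp only [Sym2.eq_iff, Prod.mk.injEq] at h
  omega

/-- Being a number of bonds, `S.order k` is nonnegative, so the subtraction in `ord` is not
truncated. The later uses of `hS` rest on this. -/
theorem ord_eq_order (hS : ∃ K, IsKekule S.graph K) (k : Fin m) : (S.ord k : ℤ) = S.order k := by
  obtain ⟨K, hK⟩ := hS
  have h := (S.isConfig_of_isKekule hK).tally_eq_order (k := k) (by omega) (by omega)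
  have h0 : 0 ≤ S.order k := by
    rw [← h]
    exact Int.natCast_nonneg _
  rw [ord, ncard_interface]
  rw [order, left_coe, right_coe] at *
  omega

end RegularStrip

namespace RegularStrip

variable {m n : ℕ} {S : RegularStrip m n}

/-! ### Placements of the double interface bonds -/

theorem Dib.ext_of_eq {s t : S.Dib} (h : ((s.tier : ℕ) : ℤ) = ((t.tier : ℕ) : ℤ))
    (h' : ((s.idx : ℕ) : ℤ) = ((t.idx : ℕ) : ℤ)) : s = t := by
  obtain ⟨k, i⟩ := s
  obtain ⟨l, j⟩ := t
  obtain rfl : k = l := Fin.ext (by exact_mod_cast h)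
  obtain rfl : i = j := Fin.ext (by exact_mod_cast h')
  rfl

theorem order_neg_one : S.order (-1) = 0 := by
  rw [order, right_neg_one, left_neg_one, right_zero]
  omega

theorem order_m : S.order m = 0 := by
  rw [order, right_m, left_m, right_pred_m]
  omega

theorem exists_dib (hS : ∃ K, IsKekule S.graph K) {k j : ℤ} (h0 : -1 ≤ k) (hm : k ≤ m)
    (hj : 0 ≤ j) (hj' : j < S.order k) :
    ∃ s : S.Dib, ((s.tier : ℕ) : ℤ) = k ∧ ((s.idx : ℕ) : ℤ) = j := by
  rcases eq_or_lt_of_le h0 with rfl | h0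
  · rw [order_neg_one] at hj'
    omega
  rcases eq_or_lt_of_le hm with rfl | hm
  · rw [order_m] at hj'
    omega
  obtain ⟨i, rfl⟩ := exists_tier (show 0 ≤ k by omega) hm
  rw [← ord_eq_order hS] at hj'
  exact ⟨⟨i, ⟨j.toNat, by omega⟩⟩, rfl, by simp only; omega⟩

theorem Dib.idx_lt_order (hS : ∃ K, IsKekule S.graph K) (s : S.Dib) :
    ((s.idx : ℕ) : ℤ) < S.order s.tier := by
  rw [← ord_eq_order hS]
  exact_mod_cast s.idx.2

theorem order_outer_inner {r : ℤ} (h0 : 0 ≤ r) (hm : r ≤ m) :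
    S.order (S.inner r) ≤ S.order (S.outer r) ∧
      S.order (S.outer r) ≤ S.order (S.inner r) + 1 := by
  have h := S.outer_inner h0 hm
  unfold order
  omega

theorem order_outer_sub_inner {r : ℤ} (h0 : 0 ≤ r) (hm : r ≤ m) :
    (S.right (S.inner r) < S.right (S.outer r) →
      S.order (S.outer r) = S.order (S.inner r) + 1) ∧
    (S.right (S.outer r) < S.right (S.inner r) → S.order (S.outer r) = S.order (S.inner r)) := by
  have h := S.outer_inner h0 hm
  generalize S.outer r = o at *
  generalize S.inner r = i at *
  unfold order
  rcases h with ⟨⟨rfl, rfl⟩ | ⟨rfl, rfl⟩, h⟩ <;> omega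

theorem Dib.cover_of_outer {s t : S.Dib} {r : ℤ} (h0 : 0 ≤ r) (hm : r ≤ m)
    (hs : ((s.tier : ℕ) : ℤ) = S.outer r) (ht : ((t.tier : ℕ) : ℤ) = S.inner r)
    (h : ((t.idx : ℕ) : ℤ) = s.idx) : Cover s t := by
  have := S.outer_inner h0 hm
  rw [← hs, ← ht, left_coe, left_coe] at this
  exact ⟨by omega, Or.inl ⟨by omega, by omega⟩⟩

theorem Dib.cover_of_inner {s t : S.Dib} {r : ℤ} (h0 : 0 ≤ r) (hm : r ≤ m)
    (hs : ((s.tier : ℕ) : ℤ) = S.inner r) (ht : ((t.tier : ℕ) : ℤ) = S.outer r)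
    (h : ((t.idx : ℕ) : ℤ) = s.idx + 1) : Cover s t := by
  have := S.outer_inner h0 hm
  rw [← hs, ← ht, left_coe, left_coe] at this
  exact ⟨by omega, Or.inr ⟨by omega, by omega⟩⟩

theorem Dib.Cover.exists_line {s t : S.Dib} (h : Cover s t) : ∃ r : ℤ, 0 ≤ r ∧ r ≤ m ∧
    ((((s.tier : ℕ) : ℤ) = S.outer r ∧ ((t.tier : ℕ) : ℤ) = S.inner r ∧
        ((t.idx : ℕ) : ℤ) = s.idx) ∨
      (((s.tier : ℕ) : ℤ) = S.inner r ∧ ((t.tier : ℕ) : ℤ) = S.outer r ∧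
        ((t.idx : ℕ) : ℤ) = s.idx + 1)) := by
  obtain ⟨ht, h⟩ := h
  have hs1 := s.tier.2
  have ht1 := t.tier.2
  rw [← left_coe, ← left_coe] at h
  rcases ht with ht | ht
  · refine ⟨((t.tier : ℕ) : ℤ), by omega, by omega, ?_⟩
    have e : (((t.tier : ℕ) : ℤ)) - 1 = ((s.tier : ℕ) : ℤ) := by omega
    unfold outer inner
    rw [e]
    split_ifs <;> omega
  · refine ⟨((s.tier : ℕ) : ℤ), by omega, by omega, ?_⟩
    have e : (((s.tier : ℕ) : ℤ)) - 1 = ((t.tier : ℕ) : ℤ) := by omega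
    unfold outer inner
    rw [e]
    split_ifs <;> omega

/-- `Cover` never relates bonds of one tier directly. On the line above the tier, however, the
orders of the two tiers differ by at most 1 in the right direction, so the tier above has a bond
between two consecutive ones. The virtual tier makes the case of the top tier vacuous. -/
theorem Dib.exists_cover_between (hS : ∃ K, IsKekule S.graph K) {s t : S.Dib}
    (h : ((s.tier : ℕ) : ℤ) = ((t.tier : ℕ) : ℤ)) (h' : ((t.idx : ℕ) : ℤ) = s.idx + 1) :
    ∃ u, Cover s u ∧ Cover u t := by
  have h0 : 0 ≤ ((s.tier : ℕ) : ℤ) := by omega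
  have hm : ((s.tier : ℕ) : ℤ) ≤ m := by omega
  have hoi := S.outer_inner h0 hm
  have hord := S.order_outer_inner h0 hm
  have hs := s.idx_lt_order hS
  have ht := t.idx_lt_order hS
  rw [← h] at ht
  rcases hoi.1 with ⟨ho, hi⟩ | ⟨ho, hi⟩
  · obtain ⟨u, hu, hu'⟩ := exists_dib hS (k := S.outer s.tier) (j := s.idx + 1) (by omega) (by omega)
      (by omega) (by rw [hi] at hord; omega)
    exact ⟨u, cover_of_inner h0 hm hi.symm hu hu',
      cover_of_outer h0 hm hu (h.symm.trans hi.symm) (by omega)⟩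
  · obtain ⟨u, hu, hu'⟩ := exists_dib hS (k := S.inner s.tier) (j := s.idx) (by omega) (by omega)
      (by omega) (by rw [ho] at hord; omega)
    exact ⟨u, cover_of_outer h0 hm ho.symm hu hu',
      cover_of_inner h0 hm hu (h.symm.trans ho.symm) (by omega)⟩

theorem Dib.le_of_idx_le (hS : ∃ K, IsKekule S.graph K) (d : ℕ) {s t : S.Dib}
    (h : ((s.tier : ℕ) : ℤ) = ((t.tier : ℕ) : ℤ)) (h' : ((t.idx : ℕ) : ℤ) = s.idx + d) :
    s ≤ t := by
  induction d generalizing t with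
  | zero => exact le_of_eq (ext_of_eq h (by omega))
  | succ d ih =>
    have ht := t.idx_lt_order hS
    have htm := t.tier.2
    obtain ⟨v, hv, hv'⟩ := exists_dib hS (k := t.tier) (j := s.idx + d) (by omega) (by omega)
      (by omega) (by omega)
    obtain ⟨u, hu1, hu2⟩ := exists_cover_between hS hv (by omega)
    exact (ih (h.trans hv.symm) hv').trans
      (show v ≤ t from (Relation.ReflTransGen.single hu1).tail hu2)

/-- The set of vertical bonds given by their columns. -/
def bonds (p : S.Dib → ℤ) (k c : ℤ) : Prop := ∃ s : S.Dib, ((s.tier : ℕ) : ℤ) = k ∧ p s = c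

/-- Columns for the double interface bonds that increase along each tier. -/
structure IsRowMono (p : S.Dib → ℤ) : Prop where
  left_le : ∀ s, S.left s.tier ≤ p s
  le_right : ∀ s, p s ≤ S.right s.tier
  even : ∀ s, ((s.tier : ℕ) + p s) % 2 = 0
  lt : ∀ s t : S.Dib, ((s.tier : ℕ) : ℤ) = ((t.tier : ℕ) : ℤ) → ((s.idx : ℕ) : ℤ) < t.idx → p s < p t

theorem IsRowMono.add_two_mul_le (hS : ∃ K, IsKekule S.graph K) {p : S.Dib → ℤ}
    (hp : IsRowMono p) (d : ℕ) {s t : S.Dib} (h : ((s.tier : ℕ) : ℤ) = ((t.tier : ℕ) : ℤ))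
    (h' : ((t.idx : ℕ) : ℤ) = s.idx + d) : p s + 2 * d ≤ p t := by
  induction d generalizing t with
  | zero => rw [Dib.ext_of_eq h (by omega)]; omega
  | succ d ih =>
    have ht := t.idx_lt_order hS
    have htm := t.tier.2
    obtain ⟨v, hv, hv'⟩ := exists_dib hS (k := t.tier) (j := s.idx + d) (by omega) (by omega)
      (by omega) (by omega)
    have h1 := ih (h.trans hv.symm) hv'
    have h2 := hp.lt v t hv (by omega)
    have h3 := hp.even v
    have h4 := hp.even t
    omega

theorem IsRowMono.tally_eq_card {p : S.Dib → ℤ} (hp : IsRowMono p) (k c : ℤ) :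
    ∃ J : Finset ℕ, S.tally (bonds p) k c = J.card ∧
      ∀ j : ℕ, j ∈ J ↔ ∃ s : S.Dib, ((s.tier : ℕ) : ℤ) = k ∧ (s.idx : ℕ) = j ∧ p s ≤ c := by
  classical
  let F : Finset S.Dib := {s | ((s.tier : ℕ) : ℤ) = k ∧ p s ≤ c}
  have hF : ∀ s, s ∈ F ↔ ((s.tier : ℕ) : ℤ) = k ∧ p s ≤ c := fun s => by simp [F]
  refine ⟨F.image fun s => (s.idx : ℕ), ?_, ?_⟩
  · rw [Finset.card_image_of_injOn, tally]
    · have : (Finset.Icc (S.left k) c).filter (bonds p k) = F.image p := by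
        ext x
        simp only [Finset.mem_filter, Finset.mem_Icc, Finset.mem_image, hF]
        constructor
        · rintro ⟨h, s, rfl, rfl⟩
          exact ⟨s, ⟨rfl, h.2⟩, rfl⟩
        · rintro ⟨s, ⟨rfl, h⟩, rfl⟩
          exact ⟨⟨hp.left_le s, h⟩, s, rfl, rfl⟩
      rw [this, Finset.card_image_of_injOn]
      intro s hs t ht hst
      have hs := ((hF s).1 hs).1
      have ht := ((hF t).1 ht).1
      have h1 := hp.lt s t (hs.trans ht.symm)
      have h2 := hp.lt t s (ht.trans hs.symm)
      exact Dib.ext_of_eq (hs.trans ht.symm) (by have : p s = p t := hst; omega)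
    · intro s hs t ht hst
      exact Dib.ext_of_eq (((hF s).1 hs).1.trans ((hF t).1 ht).1.symm) (by exact_mod_cast hst)
  · intro j
    simp only [Finset.mem_image, hF]
    constructor
    · rintro ⟨s, ⟨h1, h2⟩, h3⟩
      exact ⟨s, h1, h3, h2⟩
    · rintro ⟨s, h1, h3, h2⟩
      exact ⟨s, ⟨h1, h2⟩, h3⟩

/-- The bonds of a tier up to column `c` form an initial segment of the indices, of size the tally.
This translates between positions and counts. -/
theorem IsRowMono.idx_lt_tally (hS : ∃ K, IsKekule S.graph K) {p : S.Dib → ℤ} (hp : IsRowMono p)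
    {s : S.Dib} {k c : ℤ} (hs : ((s.tier : ℕ) : ℤ) = k) :
    ((s.idx : ℕ) : ℤ) < S.tally (bonds p) k c ↔ p s ≤ c := by
  obtain ⟨J, hJ, hmem⟩ := hp.tally_eq_card k c
  rw [hJ]
  constructor
  · intro h
    by_contra hc
    have : J ⊆ Finset.range s.idx := by
      intro j hj
      obtain ⟨t, ht, rfl, htc⟩ := (hmem j).1 hj
      rw [Finset.mem_range]
      by_contra hst
      rcases eq_or_lt_of_le (show ((s.idx : ℕ) : ℤ) ≤ t.idx by omega) with h' | h'
      · rw [Dib.ext_of_eq (hs.trans ht.symm) h'] at hc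
        exact hc htc
      · have := hp.lt s t (hs.trans ht.symm) h'
        omega
    have := Finset.card_le_card this
    rw [Finset.card_range] at this
    omega
  · intro h
    have : Finset.range (s.idx + 1) ⊆ J := by
      intro j hj
      rw [Finset.mem_range] at hj
      have h1 := s.idx_lt_order hS
      have h2 := s.tier.2
      obtain ⟨t, ht, htj⟩ := exists_dib hS (k := k) (j := j) (by omega) (by omega)
        (by omega) (by rw [← hs]; omega)
      refine (hmem j).2 ⟨t, ht, by omega, ?_⟩
      rcases eq_or_lt_of_le (show ((t.idx : ℕ) : ℤ) ≤ s.idx by omega) with h' | h'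
      · rwa [Dib.ext_of_eq (ht.trans hs.symm) h']
      · have := hp.lt t s (ht.trans hs.symm) h'
        omega
    have := Finset.card_le_card this
    rw [Finset.card_range] at this
    omega

theorem IsRowMono.tally_le_order (hS : ∃ K, IsKekule S.graph K) {p : S.Dib → ℤ} (hp : IsRowMono p)
    {k : ℤ} (h0 : -1 ≤ k) (hm : k ≤ m) (c : ℤ) : S.tally (bonds p) k c ≤ S.order k := by
  obtain ⟨J, hJ, hmem⟩ := hp.tally_eq_card k c
  rw [hJ]
  have hpos : 0 ≤ S.order k := by
    rcases eq_or_lt_of_le h0 with rfl | h0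
    · rw [order_neg_one]
    rcases eq_or_lt_of_le hm with rfl | hm
    · rw [order_m]
    obtain ⟨i, rfl⟩ := exists_tier (show 0 ≤ k by omega) hm
    rw [← ord_eq_order hS]
    omega
  have : J ⊆ Finset.range (S.order k).toNat := by
    intro j hj
    obtain ⟨t, rfl, rfl, htc⟩ := (hmem j).1 hj
    have := t.idx_lt_order hS
    rw [Finset.mem_range]
    omega
  have := Finset.card_le_card this
  rw [Finset.card_range] at this
  omega

theorem tally_nonneg (V : ℤ → ℤ → Prop) (k c : ℤ) : 0 ≤ S.tally V k c := Int.natCast_nonneg _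

theorem IsRowMono.tally_eq_order (hS : ∃ K, IsKekule S.graph K) {p : S.Dib → ℤ} (hp : IsRowMono p)
    {k c : ℤ} (h0 : -1 ≤ k) (hm : k ≤ m) (hc : S.right k ≤ c) :
    S.tally (bonds p) k c = S.order k := by
  apply le_antisymm (hp.tally_le_order hS h0 hm c)
  by_contra h
  obtain ⟨s, rfl, hs'⟩ := exists_dib hS h0 hm (tally_nonneg _ _ _) (not_le.1 h)
  have := (hp.idx_lt_tally hS (c := c) rfl).2 ((hp.le_right s).trans hc)
  omega

/-- Columns for the double interface bonds that increase along each tier and interlace in adjacent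
tiers. -/
structure IsPlacement (p : S.Dib → ℤ) : Prop extends IsRowMono p where
  lt_of_cover : ∀ s t, Dib.Cover s t → p s < p t

/-- Across a line the covers form one chain: outer bond 0, inner bond 0, outer bond 1, inner bond 1,
and so on. Any column cuts it into an initial and a final segment. -/
theorem IsPlacement.tally_interlace (hS : ∃ K, IsKekule S.graph K) {p : S.Dib → ℤ}
    (hp : IsPlacement p) {r : ℤ} (h0 : 0 ≤ r) (hm : r ≤ m) (c : ℤ) :
    S.tally (bonds p) (S.inner r) c ≤ S.tally (bonds p) (S.outer r) c ∧
      S.tally (bonds p) (S.outer r) c ≤ S.tally (bonds p) (S.inner r) c + 1 := by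
  have hoi := S.outer_inner h0 hm
  have hord := S.order_outer_inner h0 hm
  have ho := hp.tally_le_order hS (k := S.outer r) (by omega) (by omega) c
  have hi := hp.tally_le_order hS (k := S.inner r) (by omega) (by omega) c
  have hi0 := tally_nonneg (S := S) (bonds p) (S.inner r) c
  have ho0 := tally_nonneg (S := S) (bonds p) (S.outer r) c
  constructor
  · by_contra h
    obtain ⟨s, hs, hs'⟩ := exists_dib hS (k := S.outer r) (j := S.tally (bonds p) (S.outer r) c)
      (by omega) (by omega) ho0 (by omega)
    obtain ⟨t, ht, ht'⟩ := exists_dib hS (k := S.inner r) (j := S.tally (bonds p) (S.outer r) c)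
      (by omega) (by omega) ho0 (by omega)
    have h1 := (hp.idx_lt_tally hS (c := c) ht).1 (by omega)
    have h2 := hp.lt_of_cover s t (Dib.cover_of_outer h0 hm hs ht (by omega))
    have h3 := (hp.idx_lt_tally hS (c := c) hs).2 (by omega)
    omega
  · by_contra h
    obtain ⟨s, hs, hs'⟩ := exists_dib hS (k := S.outer r)
      (j := S.tally (bonds p) (S.inner r) c + 1) (by omega) (by omega) (by omega) (by omega)
    obtain ⟨t, ht, ht'⟩ := exists_dib hS (k := S.inner r) (j := S.tally (bonds p) (S.inner r) c)
      (by omega) (by omega) hi0 (by omega)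
    have h1 := (hp.idx_lt_tally hS (c := c) hs).1 (by omega)
    have h2 := hp.lt_of_cover t s (Dib.cover_of_inner h0 hm ht hs (by omega))
    have h3 := (hp.idx_lt_tally hS (c := c) ht).2 (by omega)
    omega

variable (S) in
/-- The horizontal bonds that are determined by the vertical bonds of a Kekulé structure. -/
def horiz (V : ℤ → ℤ → Prop) (r c : ℤ) : Prop :=
  (r, c) ∈ S.graph.verts ∧ (r, c + 1) ∈ S.graph.verts ∧
    (((c - S.left (S.outer r)) % 2 = 0 ∧
        S.tally V (S.outer r) c - S.tally V (S.inner r) c = 0) ∨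
      ((c - S.left (S.outer r)) % 2 = 1 ∧
        S.tally V (S.outer r) c - S.tally V (S.inner r) c = 1))

theorem IsConfig.horiz_iff {e V : ℤ → ℤ → Prop} (h : S.IsConfig e V) (r c : ℤ) :
    e r c ↔ S.horiz V r c := by
  unfold horiz
  constructor
  · intro he
    obtain ⟨h1, h2⟩ := h.hor_mem he
    have hr := (S.mem_verts.1 h1).1
    have h3 := (S.mem_verts_iff_outer hr.1 hr.2).1 h1
    have h4 := h.tally_sub hr.1 hr.2 (c := c) (by omega) (by omega)
    rw [ind_of he] at h4
    exact ⟨h1, h2, by omega⟩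
  · rintro ⟨h1, h2, h5⟩
    have hr := (S.mem_verts.1 h1).1
    have h3 := (S.mem_verts_iff_outer hr.1 hr.2).1 h1
    have h4 := h.tally_sub hr.1 hr.2 (c := c) (by omega) (by omega)
    exact of_ind_eq_one (by omega)

theorem IsPlacement.ind_horiz (hS : ∃ K, IsKekule S.graph K) {p : S.Dib → ℤ}
    (hp : IsPlacement p) {r c : ℤ} (hv : (r, c) ∈ S.graph.verts) :
    ((c - S.left (S.outer r)) % 2 = 0 → ind (S.horiz (bonds p) r c) =
      1 - (S.tally (bonds p) (S.outer r) c - S.tally (bonds p) (S.inner r) c)) ∧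
    ((c - S.left (S.outer r)) % 2 = 1 → ind (S.horiz (bonds p) r c) =
      S.tally (bonds p) (S.outer r) c - S.tally (bonds p) (S.inner r) c) := by
  obtain ⟨h0, hm⟩ := (S.mem_verts.1 hv).1
  have t1 := hp.tally_interlace hS h0 hm c
  by_cases hv' : (r, c + 1) ∈ S.graph.verts
  · rcases ind_cases (S.horiz (bonds p) r c) with ⟨a, ha⟩ | ⟨a, ha⟩ <;>
      simp only [horiz, hv, hv', true_and] at a <;> omega
  -- At the right end both tallies are full, and the difference of the orders is exactly the value
  -- that encodes a missing bond.
  · rw [ind_of_not fun h => hv' h.2.1]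
    have hoi := S.outer_inner h0 hm
    have o1 : S.right (S.outer r) ≤ c → _ := hp.tally_eq_order hS (by omega) (by omega)
    have o2 : S.right (S.inner r) ≤ c → _ := hp.tally_eq_order hS (by omega) (by omega)
    have o3 := S.order_outer_sub_inner h0 hm
    rw [S.mem_verts_iff_outer h0 hm] at hv hv'
    rw [o1 (by omega), o2 (by omega)]
    generalize S.outer r = o at *
    generalize S.inner r = i at *
    rcases hoi with ⟨⟨rfl, rfl⟩ | ⟨rfl, rfl⟩, h⟩ <;> omega

theorem IsPlacement.ind_horiz_pred (hS : ∃ K, IsKekule S.graph K) {p : S.Dib → ℤ}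
    (hp : IsPlacement p) {r c : ℤ} (hv : (r, c) ∈ S.graph.verts) :
    ((c - S.left (S.outer r)) % 2 = 0 → ind (S.horiz (bonds p) r (c - 1)) =
      S.tally (bonds p) (S.outer r) (c - 1) - S.tally (bonds p) (S.inner r) (c - 1)) ∧
    ((c - S.left (S.outer r)) % 2 = 1 → ind (S.horiz (bonds p) r (c - 1)) =
      1 - (S.tally (bonds p) (S.outer r) (c - 1) - S.tally (bonds p) (S.inner r) (c - 1))) := by
  obtain ⟨h0, hm⟩ := (S.mem_verts.1 hv).1
  by_cases hv' : (r, c - 1) ∈ S.graph.verts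
  · have := hp.ind_horiz hS hv'
    omega
  · rw [ind_of_not fun h => hv' h.1]
    have hoi := S.outer_inner h0 hm
    rw [S.mem_verts_iff_outer h0 hm] at hv hv'
    rw [tally_eq_zero (by omega), tally_eq_zero (by omega)]
    omega

/-- Once both horizontal bonds at a vertex are expressed by tally differences, the matching law
there is just `tally_succ` for the two tiers. -/
theorem IsPlacement.isConfig (hS : ∃ K, IsKekule S.graph K) {p : S.Dib → ℤ}
    (hp : IsPlacement p) : S.IsConfig (S.horiz (bonds p)) (bonds p) where
  vert_mem := by
    rintro k c ⟨s, rfl, rfl⟩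
    have := s.tier.2
    exact ⟨by omega, hp.left_le s, hp.le_right s, hp.even s⟩
  hor_mem h := ⟨h.1, h.2.1⟩
  law := by
    intro r c hv
    obtain ⟨h0, hm⟩ := (S.mem_verts.1 hv).1
    have hoi := S.outer_inner h0 hm
    have hV : ∀ k c, bonds p k c → S.left k ≤ c := by
      rintro k c ⟨s, rfl, rfl⟩
      exact hp.left_le s
    have hpar : ∀ k c, (k + c) % 2 = 1 → ind (bonds p k c) = 0 := by
      rintro k c hi
      apply ind_of_not
      rintro ⟨s, rfl, rfl⟩
      have := hp.even s
      omega
    have s1 := tally_succ hV (S.outer r) c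
    have s2 := tally_succ hV (S.inner r) c
    have p1 := hpar r c
    have p2 := hpar (r - 1) c
    have h1 := hp.ind_horiz hS hv
    have h2 := hp.ind_horiz_pred hS hv
    clear hpar hV
    generalize S.outer r = o at *
    generalize S.inner r = i at *
    rcases hoi with ⟨⟨rfl, rfl⟩ | ⟨rfl, rfl⟩, h⟩ <;> omega

/-- List the vertical bonds of each tier from left to right; `IsConfig.tally_eq_order` says that
their number is the required one. -/
theorem IsConfig.exists_isPlacement (hS : ∃ K, IsKekule S.graph K) {e V : ℤ → ℤ → Prop}
    (h : S.IsConfig e V) : ∃ p : S.Dib → ℤ, IsPlacement p ∧ bonds p = V := by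
  classical
  let J : Fin m → Finset ℤ := fun k =>
    (Finset.Icc (S.left (k : ℕ)) (S.right (k : ℕ))).filter (V (k : ℕ))
  have hJ : ∀ k, (J k).card = S.ord k := by
    intro k
    have h1 := h.tally_eq_order (k := (k : ℕ)) (by omega) (by omega)
    rw [← ord_eq_order hS] at h1
    unfold tally at h1
    have : (J k).card = ((Finset.Icc (S.left (k : ℕ)) (S.right (k : ℕ))).filter (V (k : ℕ))).card := by
      simp only [J]
    rw [this]
    convert Nat.cast_injective h1
  let p : S.Dib → ℤ := fun s => (J s.tier).orderEmbOfFin (hJ s.tier) s.idx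
  have hmem : ∀ s, p s ∈ J s.tier := fun s => Finset.orderEmbOfFin_mem _ _ _
  have hV : ∀ s : S.Dib, V (s.tier : ℕ) (p s) := fun s => (Finset.mem_filter.1 (hmem s)).2
  have hb : bonds p = V := by
    funext k c
    apply propext
    constructor
    · rintro ⟨s, rfl, rfl⟩
      exact hV s
    · intro hc
      obtain ⟨⟨h0, hm⟩, hl, hr, -⟩ := h.vert_mem hc
      obtain ⟨i, rfl⟩ := exists_tier h0 hm
      have : c ∈ J i := Finset.mem_filter.2 ⟨Finset.mem_Icc.2 ⟨hl, hr⟩, hc⟩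
      rw [← Finset.mem_coe, ← Finset.range_orderEmbOfFin _ (hJ i)] at this
      obtain ⟨j, hj⟩ := this
      exact ⟨⟨i, j⟩, rfl, hj⟩
  have hrow : IsRowMono p := by
    refine ⟨fun s => (h.vert_mem (hV s)).2.1, fun s => (h.vert_mem (hV s)).2.2.1,
      fun s => (h.vert_mem (hV s)).2.2.2, ?_⟩
    rintro ⟨k, i⟩ ⟨l, j⟩ hkl hij
    obtain rfl : k = l := Fin.ext (by exact_mod_cast hkl)
    exact (Finset.orderEmbOfFin _ _).strictMono (show i < j from by
      rw [Fin.lt_def]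
      exact_mod_cast hij)
  refine ⟨p, ⟨hrow, ?_⟩, hb⟩
  intro s t hst
  obtain ⟨r, h0, hm, hst⟩ := hst.exists_line
  have hoi := S.outer_inner h0 hm
  have hs := hrow.even s
  have ht := hrow.even t
  have hl := hrow.left_le t
  have hr := hrow.le_right t
  -- Comparing tallies at the column of `t` gives `p s ≤ p t`; columns in adjacent tiers have
  -- opposite parity, so the inequality is strict.
  have h1 := h.tally_sub h0 hm (c := p t)
    (by rcases hst with ⟨e1, e2, -⟩ | ⟨e1, e2, -⟩ <;> rw [e2] at hl <;> omega)
    (by rcases hst with ⟨e1, e2, -⟩ | ⟨e1, e2, -⟩ <;> rw [e2] at hr <;> omega)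
  have h2 := ind_eq_zero_or_one (e r (p t))
  rw [← hb] at h1
  rcases hst with ⟨e1, e2, h3⟩ | ⟨e1, e2, h3⟩
  · have h4 := (hrow.idx_lt_tally hS (c := p t) e2).2 le_rfl
    have h5 := (hrow.idx_lt_tally hS (c := p t) e1).1 (by omega)
    omega
  · have h4 := (hrow.idx_lt_tally hS (c := p t) e2).2 le_rfl
    have h5 := (hrow.idx_lt_tally hS (c := p t) e1).1 (by omega)
    omega

/-! ### Kekulé structures and weakly order-preserving maps -/

/-- The leftmost position of a double interface bond. -/
def Dib.base (s : S.Dib) : ℤ := S.left s.tier + 2 * (s.idx : ℕ)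

/-- The column of a double interface bond that is moved to the right by `g s` hexagons. -/
def col (g : S.Dib → Fin (n + 1)) (s : S.Dib) : ℤ := s.base + 2 * ((g s : ℕ) : ℤ)

/-- Since a displacement counts twice in the column, this shift by 1 makes `col g s < col g t`
equivalent to `g s ≤ g t` along a cover. -/
theorem Dib.Cover.base_eq {s t : S.Dib} (h : Cover s t) : t.base = s.base + 1 := by
  have := h.column
  rwa [← left_coe, ← left_coe] at this

theorem isPlacement_col (hS : ∃ K, IsKekule S.graph K) {g : S.Dib → Fin (n + 1)}
    (hg : Monotone g) : IsPlacement (col g) := by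
  have hmono : ∀ {s t}, s ≤ t → ((g s : ℕ) : ℤ) ≤ (g t : ℕ) := fun h => by exact_mod_cast hg h
  refine ⟨⟨?_, ?_, ?_, ?_⟩, ?_⟩
  · intro s
    simp only [col, Dib.base]
    omega
  · intro s
    have h1 := s.idx_lt_order hS
    have h2 := (g s).2
    simp only [col, Dib.base]
    unfold order at h1
    omega
  · intro s
    have h1 := s.tier.2
    have h2 := S.left_mod_two (k := (s.tier : ℕ)) (by omega) (by omega)
    simp only [col, Dib.base]
    omega
  · intro s t h h'
    have h1 := hmono (Dib.le_of_idx_le hS (t.idx - s.idx : ℕ) h (by omega))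
    simp only [col, Dib.base, h]
    omega
  · intro s t h
    have h1 := hmono (show s ≤ t from Relation.ReflTransGen.single h)
    have h2 := h.base_eq
    simp only [col, h2]
    omega

theorem IsPlacement.exists_col (hS : ∃ K, IsKekule S.graph K) {p : S.Dib → ℤ}
    (hp : IsPlacement p) : ∃ g : S.Dib → Fin (n + 1), Monotone g ∧ col g = p := by
  have hex : ∀ s : S.Dib, ∃ i : Fin (n + 1), s.base + 2 * ((i : ℕ) : ℤ) = p s := by
    intro s
    have h1 := s.idx_lt_order hS
    have h2 := s.tier.2
    -- Here `a` and `b` are the first and the last bond of the tier. The bonds on either side of `s`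
    -- take up two columns each, which confines `p s` to the range from `s.base` to `s.base + 2 *
    -- n`.
    obtain ⟨a, ha, ha'⟩ := exists_dib hS (k := s.tier) (j := 0) (by omega) (by omega) le_rfl
      (by omega)
    obtain ⟨b, hb, hb'⟩ := exists_dib hS (k := s.tier) (j := S.order s.tier - 1) (by omega)
      (by omega) (by omega) (by omega)
    have h3 := hp.add_two_mul_le hS s.idx ha (by omega)
    have h4 := hp.add_two_mul_le hS (b.idx - s.idx : ℕ) hb.symm (by omega)
    have h5 := hp.left_le a
    have h6 := hp.le_right b
    rw [ha] at h5
    rw [hb] at h6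
    have h7 := S.left_mod_two (k := (s.tier : ℕ)) (by omega) (by omega)
    have h8 := hp.even s
    refine ⟨⟨((p s - s.base) / 2).toNat, ?_⟩, ?_⟩
    · unfold Dib.base order at *
      omega
    · unfold Dib.base order at *
      simp only
      omega
  choose g hg using hex
  refine ⟨g, ?_, funext hg⟩
  have hc : ∀ s t, Dib.Cover s t → g s ≤ g t := by
    intro s t h
    have h1 := hp.lt_of_cover s t h
    have h2 := h.base_eq
    rw [← hg, ← hg] at h1
    rw [Fin.le_def]
    omega
  intro s t h
  change Relation.ReflTransGen Dib.Cover s t at h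
  induction h with
  | refl => exact le_rfl
  | tail _ h ih => exact ih.trans (hc _ _ h)

theorem IsRowMono.bonds_injective {p q : S.Dib → ℤ} (hS : ∃ K, IsKekule S.graph K)
    (hp : IsRowMono p) (hq : IsRowMono q) (h : bonds p = bonds q) : p = q := by
  funext s
  have h1 := hp.idx_lt_tally hS (s := s) (c := p s) rfl
  have h2 := hq.idx_lt_tally hS (s := s) (c := p s) rfl
  have h3 := hp.idx_lt_tally hS (s := s) (c := q s) rfl
  have h4 := hq.idx_lt_tally hS (s := s) (c := q s) rfl
  rw [h] at h1 h3
  omega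

variable (S) in
/-- The Kekulé structure that belongs to a weakly order-preserving map. -/
def kekule (g : S.Dib → Fin (n + 1)) : hexLattice.Subgraph :=
  S.ofBonds (S.horiz (bonds (col g))) (bonds (col g))

theorem isKekule_kekule (hS : ∃ K, IsKekule S.graph K) {g : S.Dib → Fin (n + 1)}
    (hg : Monotone g) : IsKekule S.graph (S.kekule g) :=
  ((isPlacement_col hS hg).isConfig hS).isKekule

theorem bijective_kekule (hS : ∃ K, IsKekule S.graph K) : Function.Bijective
    (fun g : {g : S.Dib → Fin (n + 1) // Monotone g} =>
      (⟨S.kekule g.1, isKekule_kekule hS g.2⟩ : {K // IsKekule S.graph K})) := by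
  constructor
  · rintro ⟨g, hg⟩ ⟨g', hg'⟩ h
    have h : S.kekule g = S.kekule g' := congrArg Subtype.val h
    have hb : bonds (col g) = bonds (col g') := by
      funext k c
      apply propext
      rw [← ((isPlacement_col hS hg).isConfig hS).ofBonds_vertical,
        ← ((isPlacement_col hS hg').isConfig hS).ofBonds_vertical]
      exact iff_of_eq (congrArg (fun K => K.Adj (k, c) (k + 1, c)) h)
    have hcol := (isPlacement_col hS hg).bonds_injective hS (isPlacement_col hS hg').toIsRowMono hb
    apply Subtype.ext
    funext s
    have : s.base + 2 * ((g s : ℕ) : ℤ) = s.base + 2 * ((g' s : ℕ) : ℤ) := congrFun hcol s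
    change g s = g' s
    exact Fin.ext (by omega)
  · rintro ⟨K, hK⟩
    have hc := S.isConfig_of_isKekule hK
    obtain ⟨p, hp, hpV⟩ := hc.exists_isPlacement hS
    obtain ⟨g, hg, rfl⟩ := hp.exists_col hS
    refine ⟨⟨g, hg⟩, Subtype.ext (subgraph_ext hK.2.1.symm ?_ ?_)⟩
    · intro r c
      rw [hc.horiz_iff, ← hpV]
      exact (hp.isConfig hS).ofBonds_horizontal
    · intro r c
      exact (hp.isConfig hS).ofBonds_vertical.trans (iff_of_eq (congrFun (congrFun hpV r) c))

end RegularStrip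

namespace RegularStrip

variable {m n : ℕ} {S : RegularStrip m n}

/-! ### Proper sextets -/

theorem IsRowMono.le_of_idx_le {p : S.Dib → ℤ} (hp : IsRowMono p) {s t : S.Dib}
    (h : ((s.tier : ℕ) : ℤ) = ((t.tier : ℕ) : ℤ)) (h' : ((s.idx : ℕ) : ℤ) ≤ t.idx) : p s ≤ p t := by
  rcases eq_or_lt_of_le h' with h' | h'
  · rw [Dib.ext_of_eq h h']
  · exact (hp.lt s t h h').le

/-- Bonds in neighbouring columns must be consecutive in the interlacing chain of their two tiers: a
wrong index would force another bond strictly between them or reverse their order. -/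
theorem IsPlacement.cover_of_eq_pred (hS : ∃ K, IsKekule S.graph K) {p : S.Dib → ℤ}
    (hp : IsPlacement p) {t s : S.Dib} (h : p t = p s - 1)
    (hts : (s.tier : ℕ) = t.tier + 1 ∨ (t.tier : ℕ) = s.tier + 1) : Dib.Cover t s := by
  have hs0 := s.tier.2
  have ht0 := t.tier.2
  have hs := s.idx_lt_order hS
  have ht := t.idx_lt_order hS
  obtain ⟨r, h0, hm, hr⟩ : ∃ r : ℤ, 0 ≤ r ∧ r ≤ m ∧
      ((((t.tier : ℕ) : ℤ) = r - 1 ∧ ((s.tier : ℕ) : ℤ) = r) ∨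
        (((t.tier : ℕ) : ℤ) = r ∧ ((s.tier : ℕ) : ℤ) = r - 1)) :=
    ⟨max (s.tier : ℕ) (t.tier : ℕ), by omega, by omega, by omega⟩
  have hoi := (S.outer_inner h0 hm).1
  have hcases : (((t.tier : ℕ) : ℤ) = S.outer r ∧ ((s.tier : ℕ) : ℤ) = S.inner r) ∨
      (((t.tier : ℕ) : ℤ) = S.inner r ∧ ((s.tier : ℕ) : ℤ) = S.outer r) := by omega
  clear hr
  rcases hcases with ⟨ht', hs'⟩ | ⟨ht', hs'⟩
  · refine Dib.cover_of_outer h0 hm ht' hs' (le_antisymm ?_ ?_) <;> by_contra hlt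
    · obtain ⟨u, hu, hu'⟩ := exists_dib hS (k := s.tier) (j := t.idx) (by omega) (by omega) (by omega)
        (by omega)
      have h1 := hp.lt_of_cover t u (Dib.cover_of_outer h0 hm ht' (hu.trans hs') hu')
      have h2 := hp.lt u s hu (by omega)
      omega
    · obtain ⟨u, hu, hu'⟩ := exists_dib hS (k := t.tier) (j := s.idx + 1) (by omega) (by omega)
        (by omega) (by omega)
      have h1 := hp.lt_of_cover s u (Dib.cover_of_inner h0 hm hs' (hu.trans ht') hu')
      have h2 := hp.le_of_idx_le hu (by omega)
      omega
  · refine Dib.cover_of_inner h0 hm ht' hs' (le_antisymm ?_ ?_) <;> by_contra hlt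
    · obtain ⟨u, hu, hu'⟩ := exists_dib hS (k := s.tier) (j := t.idx + 1) (by omega) (by omega)
        (by omega) (by omega)
      have h1 := hp.lt_of_cover t u (Dib.cover_of_inner h0 hm ht' (hu.trans hs') hu')
      have h2 := hp.lt u s hu (by omega)
      omega
    · obtain ⟨u, hu, hu'⟩ := exists_dib hS (k := t.tier) (j := s.idx) (by omega) (by omega)
        (by omega) (by omega)
      have h1 := hp.lt_of_cover s u (Dib.cover_of_outer h0 hm hs' (hu.trans ht') hu')
      have h2 := hp.le_of_idx_le hu (by omega)
      omega

theorem IsPlacement.mem_properSextets (hS : ∃ K, IsKekule S.graph K) {p : S.Dib → ℤ}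
    (hp : IsPlacement p) (h : ℤ × ℤ) :
    h ∈ S.properSextets (S.ofBonds (S.horiz (bonds p)) (bonds p)) ↔
      ∃ s : S.Dib, S.left s.tier < p s ∧ (∀ t, Dib.Cover t s → p t ≠ p s - 1) ∧
        h = (((s.tier : ℕ) : ℤ), p s - 1) := by
  have hc := hp.isConfig hS
  obtain ⟨k, c⟩ := h
  have hcov : ∀ s : S.Dib, (∀ t, Dib.Cover t s → p t ≠ p s - 1) ↔
      ind (bonds p ((s.tier : ℕ) - 1) (p s - 1)) = 0 ∧
        ind (bonds p ((s.tier : ℕ) + 1) (p s - 1)) = 0 := by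
    intro s
    constructor
    · intro h
      constructor <;> apply ind_of_not <;> rintro ⟨t, ht, htp⟩ <;>
        exact h t (hp.cover_of_eq_pred hS htp (by omega)) htp
    · rintro ⟨h1, h2⟩ t ht htp
      rcases ht.1 with h | h
      · have : ind (bonds p ((s.tier : ℕ) - 1) (p s - 1)) = 1 := ind_of ⟨t, by omega, htp⟩
        omega
      · have : ind (bonds p ((s.tier : ℕ) + 1) (p s - 1)) = 1 := ind_of ⟨t, by omega, htp⟩
        omega
  have hpar : ∀ k c, (k + c) % 2 = 1 → ind (bonds p k c) = 0 := by
    rintro k c hi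
    apply ind_of_not
    rintro ⟨s, rfl, rfl⟩
    have := hp.even s
    omega
  -- The bond `s` already matches both right vertices of the hexagon. So its top corner is matched
  -- either along the upper left edge or by the vertical bond above it, and likewise its bottom
  -- corner.
  have key : ∀ s : S.Dib, (k, c) = (((s.tier : ℕ) : ℤ), p s - 1) → S.left s.tier < p s →
      (ind (S.horiz (bonds p) k (c - 1)) = 1 ↔ ind (bonds p (k - 1) c) = 0) ∧
      (ind (S.horiz (bonds p) (k + 1) (c - 1)) = 1 ↔ ind (bonds p (k + 1) c) = 0) := by
    intro s hs hl
    obtain ⟨rfl, rfl⟩ := Prod.mk.inj hs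
    have hm := s.tier.2
    have hr := hp.le_right s
    have he := hp.even s
    have hbs : ind (bonds p (s.tier : ℕ) (p s)) = 1 := ind_of ⟨s, rfl, rfl⟩
    have l1 := hc.law (r := (s.tier : ℕ)) (c := p s) (S.mem_verts.2 (by omega))
    have l2 := hc.law (r := (s.tier : ℕ)) (c := p s - 1) (S.mem_verts.2 (by omega))
    have l3 := hc.law (r := (s.tier : ℕ) + 1) (c := p s)
      (S.mem_verts.2 (by rw [add_sub_cancel_right]; omega))
    have l4 := hc.law (r := (s.tier : ℕ) + 1) (c := p s - 1)
      (S.mem_verts.2 (by rw [add_sub_cancel_right]; omega))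
    have p1 := hpar (s.tier : ℕ) (p s - 1) (by omega)
    rw [add_sub_cancel_right] at l3 l4
    have i := fun q => ind_eq_zero_or_one q
    have i1 := i (S.horiz (bonds p) (s.tier : ℕ) (p s - 1))
    have i2 := i (S.horiz (bonds p) (s.tier : ℕ) (p s))
    have i3 := i (S.horiz (bonds p) ((s.tier : ℕ) + 1) (p s - 1))
    have i4 := i (S.horiz (bonds p) ((s.tier : ℕ) + 1) (p s))
    have i5 := i (bonds p ((s.tier : ℕ) - 1) (p s))
    have i6 := i (bonds p ((s.tier : ℕ) + 1) (p s))
    omega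
  have hadj : ∀ r, (S.ofBonds (S.horiz (bonds p)) (bonds p)).Adj (r, c - 1) (r, c) ↔
      S.horiz (bonds p) r (c - 1) := by
    intro r
    rw [← hc.ofBonds_horizontal, sub_add_cancel]
  have hind : ∀ q : Prop, q ↔ ind q = 1 := fun q => ⟨ind_of, of_ind_eq_one⟩
  simp only [properSextets, Set.mem_ofPred_eq, hc.ofBonds_vertical, hadj, S.mem_hexagons]
  constructor
  · rintro ⟨⟨hk, hl, hr, h2⟩, ⟨s, rfl, hs⟩, h3, h4⟩
    obtain rfl : c = p s - 1 := by omega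
    refine ⟨s, by omega, (hcov s).2 ?_, rfl⟩
    obtain ⟨k1, k2⟩ := key s rfl (by omega)
    exact ⟨k1.1 (ind_of h3), k2.1 (ind_of h4)⟩
  · rintro ⟨s, hl, hs, h⟩
    have k1 := key s h hl
    rw [hcov] at hs
    obtain ⟨rfl, rfl⟩ := Prod.mk.inj h
    have hr := hp.le_right s
    have he := hp.even s
    have h2 := S.left_mod_two (k := (s.tier : ℕ)) (by omega) (by omega)
    exact ⟨⟨by omega, by omega, by omega, by omega⟩, ⟨s, rfl, by omega⟩,
      of_ind_eq_one (k1.1.2 hs.1), of_ind_eq_one (k1.2.2 hs.2)⟩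

/-- For a cover `t` of the bond `s` from below, adjacent columns mean equal displacements. Together
with the condition that `s` is not in the leftmost column of its tier, their absence amounts to `s ∈
minFib g`. -/
theorem properSextets_kekule (hS : ∃ K, IsKekule S.graph K) {g : S.Dib → Fin (n + 1)}
    (hg : Monotone g) : S.properSextets (S.kekule g) =
      (fun s : S.Dib => (((s.tier : ℕ) : ℤ), col g s - 1)) '' (minFib g : Set S.Dib) := by
  ext h
  rw [kekule, (isPlacement_col hS hg).mem_properSextets hS]
  refine exists_congr fun s => ?_
  rw [Finset.mem_coe, mem_minFib, ← and_assoc, eq_comm (a := h)]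
  refine and_congr_left fun _ => ?_
  have hcov : ∀ t, Dib.Cover t s → (col g t ≠ col g s - 1 ↔ g t ≠ g s) := by
    intro t ht
    have := ht.base_eq
    rw [ne_eq, ne_eq, Fin.ext_iff]
    unfold col
    omega
  constructor
  · rintro ⟨hl, hs⟩
    have hmin : ∀ t < s, g t ≠ g s := by
      intro t ht hgt
      change Relation.TransGen Dib.Cover t s at ht
      obtain ⟨u, htu, hus⟩ := Relation.TransGen.tail'_iff.1 ht
      -- If `g t = g s` for some `t < s`, monotonicity squeezes the last element `u` of a chain from
      -- `t` to `s` to the same value.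
      refine (hcov u hus).1 (hs u hus) (le_antisymm ?_ ?_)
      · exact hg (show u ≤ s from Relation.ReflTransGen.single hus)
      · rw [← hgt]
        exact hg (show t ≤ u from htu)
    refine ⟨fun h0 => ?_, hmin⟩
    have h1 : ((g s : ℕ) : ℤ) = 0 := by rw [h0]; rfl
    unfold col Dib.base at hl
    have h2 := s.idx_lt_order hS
    have h3 := s.tier.2
    -- A bond with displacement 0 outside the leftmost column has a left neighbour in its tier, also
    -- with value 0.
    obtain ⟨t, ht, ht'⟩ := exists_dib hS (k := s.tier) (j := s.idx - 1) (by omega) (by omega)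
      (by omega) (by omega)
    have h4 : t ≤ s := Dib.le_of_idx_le hS 1 ht (by omega)
    have h5 : t ≠ s := by
      rintro rfl
      omega
    refine hmin t (lt_of_le_of_ne h4 h5) (le_antisymm (hg h4) ?_)
    rw [h0]
    exact Fin.zero_le _
  · rintro ⟨h0, hmin⟩
    constructor
    · have : (g s : ℕ) ≠ 0 := fun h => h0 (Fin.ext h)
      unfold col Dib.base
      omega
    · intro t ht
      exact (hcov t ht).2 (hmin t (show t < s from Relation.TransGen.single ht))

theorem ncard_properSextets_kekule (hS : ∃ K, IsKekule S.graph K) {g : S.Dib → Fin (n + 1)}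
    (hg : Monotone g) : (S.properSextets (S.kekule g)).ncard = (minFib g).card := by
  rw [properSextets_kekule hS hg, Set.ncard_image_of_injective, Set.ncard_coe_finset]
  intro s t h
  have hp := isPlacement_col hS hg
  obtain ⟨h1, h2⟩ := Prod.mk.inj h
  have h3 := hp.lt s t h1
  have h4 := hp.lt t s h1.symm
  exact Dib.ext_of_eq h1 (by omega)

theorem exists_equiv_kekule (hS : ∃ K, IsKekule S.graph K) :
    ∃ Φ : {g : S.Dib → Fin (n + 1) // Monotone g} ≃ {K // IsKekule S.graph K},
      ∀ g, (S.properSextets (Φ g).1).ncard = (minFib g.1).card :=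
  ⟨Equiv.ofBijective _ (bijective_kekule hS), fun g => ncard_properSextets_kekule hS g.2⟩

theorem kekuleCount_eq (hS : ∃ K, IsKekule S.graph K) (k : ℕ) : S.kekuleCount k =
    ∑ A ∈ (Finset.univ : Finset S.Dib).powersetCard k, strictOrderPoly A n := by
  obtain ⟨Φ, hΦ⟩ := exists_equiv_kekule hS
  rw [← card_minFib_card_eq, kekuleCount, ← Nat.card_coe_set_eq]
  have e1 : {g : {g : S.Dib → Fin (n + 1) // Monotone g} // (minFib g.1).card = k} ≃
      {K : {K // IsKekule S.graph K} // (S.properSextets K.1).ncard = k} :=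
    Φ.subtypeEquiv fun g => by rw [hΦ]
  rw [Nat.card_congr e1]
  exact Nat.card_congr (Equiv.subtypeSubtypeEquivSubtypeInter (IsKekule S.graph)
    (fun K => (S.properSextets K).ncard = k)).symm

end RegularStrip

/-! ### Hexagons as cycles -/

/-- The vertices of a hexagon in cyclic order. -/
def hexVertex (h : ℤ × ℤ) : Fin 6 → ℤ × ℤ :=
  ![(h.1, h.2 - 1), (h.1, h.2), (h.1, h.2 + 1), (h.1 + 1, h.2 + 1), (h.1 + 1, h.2),
    (h.1 + 1, h.2 - 1)]

theorem hexVertex_adj {h : ℤ × ℤ} (hodd : (h.1 + h.2) % 2 = 1) (i j : Fin 6) :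
    hexLattice.Adj (hexVertex h i) (hexVertex h j) ↔ (SimpleGraph.cycleGraph 6).Adj i j := by
  obtain ⟨r, c⟩ := h
  simp only at hodd
  have e : ∀ i j : Fin 6, (SimpleGraph.cycleGraph 6).Adj i j ↔ i - j = 1 ∨ j - i = 1 :=
    fun i j => SimpleGraph.cycleGraph_adj
  rw [e]
  fin_cases i <;> fin_cases j <;>
    simp only [hexVertex, Fin.zero_eta, Fin.mk_one, Fin.reduceFinMk, Matrix.cons_val,
      Matrix.cons_val_zero, Matrix.cons_val_one] <;>
    first
      | exact iff_of_true (hexLattice_adj.2 (by omega)) (by decide)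
      | exact iff_of_false (fun h => by have := hexLattice_adj.1 h; omega) (by decide)

theorem range_hexVertex (h : ℤ × ℤ) : Set.range (hexVertex h) = hexVerts h := by
  obtain ⟨r, c⟩ := h
  ext ⟨a, b⟩
  rw [mem_hexVerts]
  simp only [Set.mem_range, Fin.exists_fin_succ, hexVertex, Prod.mk.injEq, Matrix.cons_val_zero,
    Matrix.cons_val_succ, IsEmpty.exists_iff, or_false]
  omega

theorem hexVertex_injective (h : ℤ × ℤ) : Function.Injective (hexVertex h) := by
  intro i j hij
  fin_cases i <;> fin_cases j <;> first
    | rfl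
    | (exfalso
       simp only [hexVertex, Fin.zero_eta, Fin.mk_one, Fin.reduceFinMk, Matrix.cons_val,
         Matrix.cons_val_zero, Matrix.cons_val_one, Prod.mk.injEq] at hij
       omega)

theorem ncard_hexVerts (h : ℤ × ℤ) : (hexVerts h).ncard = 6 := by
  rw [← range_hexVertex, ← Set.image_univ, Set.ncard_image_of_injective _ (hexVertex_injective h),
    Set.ncard_univ, Nat.card_fin]

/-- A closed walk of length 6 without backtracking can only go around a hexagon; the step directions
are enumerated, and impossible prefixes are discarded early. -/
theorem exists_hexagon_of_closed_walk {x y : Fin 6 → ℤ}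
    (h : ∀ i, hexLattice.Adj (x i, y i) (x (i + 1), y (i + 1)))
    (hne : ∀ i, x i = x (i + 2) → y i ≠ y (i + 2)) :
    ∃ r c : ℤ, (r + c) % 2 = 1 ∧ ∀ i, (x i, y i) ∈ hexVerts (r, c) := by
  have h0 := h 0
  have h1 := h 1
  have h2 := h 2
  have h3 := h 3
  have h4 := h 4
  have h5 := h 5
  have n0 := hne 0
  have n1 := hne 1
  have n2 := hne 2
  have n3 := hne 3
  have n4 := hne 4
  have n5 := hne 5
  simp only [Fin.reduceAdd, Fin.isValue, zero_add] at h0 h1 h2 h3 h4 h5 n0 n1 n2 n3 n4 n5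
  simp only [Fin.forall_fin_succ, mem_hexVerts, IsEmpty.forall_iff, and_true]
  simp only [Fin.isValue, Fin.succ_zero_eq_one, Fin.succ_one_eq_two, Fin.reduceSucc]
  generalize x 0 = x0, x 1 = x1, x 2 = x2, x 3 = x3, x 4 = x4, x 5 = x5, y 0 = y0, y 1 = y1,
    y 2 = y2, y 3 = y3, y 4 = y4, y 5 = y5 at *
  clear h hne
  rw [hexLattice_adj] at h0 h1 h2 h3 h4 h5
  -- Opposite vertices of a hexagon lie on its two zigzag lines and are symmetric about its centre.
  refine ⟨min x0 x3, (y0 + y3) / 2, ?_⟩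
  rcases h0 with ⟨rfl, rfl | h0⟩ | ⟨rfl, ⟨rfl, h0⟩ | ⟨h0, h0'⟩⟩ <;>
    rcases h1 with ⟨rfl, rfl | h1⟩ | ⟨rfl, ⟨rfl, h1⟩ | ⟨h1, h1'⟩⟩ <;>
    try (exfalso; clear h2 h3 h4 h5 n1 n2 n3 n4 n5; omega)
  all_goals
    clear n0
    rcases h2 with ⟨rfl, rfl | h2⟩ | ⟨rfl, ⟨rfl, h2⟩ | ⟨h2, h2'⟩⟩ <;>
    try (exfalso; clear h3 h4 h5 n2 n3 n4 n5; omega)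
  all_goals
    clear n1
    rcases h3 with ⟨rfl, rfl | h3⟩ | ⟨rfl, ⟨rfl, h3⟩ | ⟨h3, h3'⟩⟩ <;>
    try (exfalso; clear h4 h5 n3 n4 n5; omega)
  all_goals
    clear n2
    rcases h4 with ⟨rfl, rfl | h4⟩ | ⟨rfl, ⟨rfl, h4⟩ | ⟨h4, h4'⟩⟩ <;>
    try (exfalso; clear n4 n5; omega)
  all_goals refine ⟨?_, ?_, ?_, ?_, ?_, ?_, ?_⟩ <;> omega

/-! ### Components of Clar covers -/

namespace SimpleGraph

variable {V W : Type*} {G : SimpleGraph V} {H : SimpleGraph W}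

/-- A connected induced subgraph without edges to the outside is a component. -/
theorem supp_eq_range_of_closed (hH : H.Connected) (f : H ↪g G)
    (hf : ∀ w x, G.Adj (f w) x → x ∈ Set.range f) (w : W) :
    (G.connectedComponentMk (f w)).supp = Set.range f := by
  have hreach : ∀ x y, G.Reachable x y → x ∈ Set.range f → y ∈ Set.range f := by
    rintro x y ⟨p⟩ hx
    induction p with
    | nil => exact hx
    | cons h _ ih =>
      obtain ⟨w, rfl⟩ := hx
      exact ih (hf w _ h)
  ext x
  rw [ConnectedComponent.mem_supp_iff, ConnectedComponent.eq]
  constructor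
  · intro h
    exact hreach _ _ h.symm ⟨w, rfl⟩
  · rintro ⟨u, rfl⟩
    exact (hH.preconnected u w).map f.toHom

theorem nonempty_iso_of_closed (hH : H.Connected) (f : H ↪g G)
    (hf : ∀ w x, G.Adj (f w) x → x ∈ Set.range f) (w : W) :
    Nonempty ((G.connectedComponentMk (f w)).toSimpleGraph ≃g H) := by
  have hs := supp_eq_range_of_closed hH f hf w
  refine ⟨RelIso.symm ⟨(Equiv.ofInjective f f.injective).trans (Equiv.setCongr hs.symm), ?_⟩⟩
  intro a b
  exact f.map_adj_iff

theorem ConnectedComponent.exists_embedding (c : G.ConnectedComponent)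
    (e : c.toSimpleGraph ≃g H) : ∃ f : H ↪g G, (∀ w x, G.Adj (f w) x → x ∈ Set.range f) ∧
      Set.range f = c.supp := by
  refine ⟨⟨⟨fun w => (e.symm w : V), fun a b h => e.symm.injective (Subtype.ext h)⟩, ?_⟩, ?_, ?_⟩
  · intro a b
    exact e.symm.map_adj_iff
  · intro w x h
    have hx : x ∈ c.supp := c.mem_supp_of_adj_mem_supp (e.symm w).2 h
    exact ⟨e ⟨x, hx⟩, congrArg Subtype.val (e.symm_apply_apply ⟨x, hx⟩)⟩
  · ext x
    constructor
    · rintro ⟨w, rfl⟩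
      exact (e.symm w).2
    · intro hx
      exact ⟨e ⟨x, hx⟩, congrArg Subtype.val (e.symm_apply_apply ⟨x, hx⟩)⟩

end SimpleGraph

/-- The vertex `v` and its only neighbour form a component of `D`. -/
def IsEdgeComponent (D : hexLattice.Subgraph) (v : ℤ × ℤ) : Prop :=
  ∃ w, D.Adj v w ∧ (∀ x, D.Adj v x → x = w) ∧ ∀ x, D.Adj w x → x = v

/-- The hexagon `h` is a component of `D`. -/
def IsHexComponent (D : hexLattice.Subgraph) (h : ℤ × ℤ) : Prop :=
  (h.1 + h.2) % 2 = 1 ∧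
    ∀ u ∈ hexVerts h, ∀ w, D.Adj u w ↔ w ∈ hexVerts h ∧ hexLattice.Adj u w

theorem exists_two_neighbors {h u : ℤ × ℤ} (hodd : (h.1 + h.2) % 2 = 1) (hu : u ∈ hexVerts h) :
    ∃ a b, a ≠ b ∧ a ∈ hexVerts h ∧ b ∈ hexVerts h ∧ hexLattice.Adj u a ∧ hexLattice.Adj u b ∧
      ∀ w ∈ hexVerts h, hexLattice.Adj u w → w = a ∨ w = b := by
  rw [← range_hexVertex] at hu ⊢
  obtain ⟨i, rfl⟩ := hu
  have e : ∀ i j : Fin 6, (SimpleGraph.cycleGraph 6).Adj i j ↔ i - j = 1 ∨ j - i = 1 :=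
    fun i j => SimpleGraph.cycleGraph_adj
  refine ⟨hexVertex h (i + 1), hexVertex h (i - 1), ?_, ⟨_, rfl⟩, ⟨_, rfl⟩, ?_, ?_, ?_⟩
  · intro h'
    have hne : ∀ i : Fin 6, i + 1 ≠ i - 1 := by decide
    exact hne i (hexVertex_injective h h')
  · rw [hexVertex_adj hodd, e]
    revert i
    decide
  · rw [hexVertex_adj hodd, e]
    revert i
    decide
  · rintro _ ⟨j, rfl⟩ hj
    rw [hexVertex_adj hodd, e] at hj
    have : j = i + 1 ∨ j = i - 1 := by
      revert i j
      decide
    rcases this with rfl | rfl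
    · exact Or.inl rfl
    · exact Or.inr rfl

theorem IsHexComponent.mem_verts {D : hexLattice.Subgraph} {h u : ℤ × ℤ} (hh : IsHexComponent D h)
    (hu : u ∈ hexVerts h) : u ∈ D.verts := by
  obtain ⟨a, -, -, ha, -, hua, -⟩ := exists_two_neighbors hh.1 hu
  exact ((hh.2 u hu a).2 ⟨ha, hua⟩).fst_mem

theorem IsHexComponent.not_isEdgeComponent {D : hexLattice.Subgraph} {h u : ℤ × ℤ}
    (hh : IsHexComponent D h) (hu : u ∈ hexVerts h) : ¬ IsEdgeComponent D u := by
  rintro ⟨w, -, hw, -⟩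
  obtain ⟨a, b, hab, ha, hb, hua, hub, -⟩ := exists_two_neighbors hh.1 hu
  exact hab ((hw a ((hh.2 u hu a).2 ⟨ha, hua⟩)).trans (hw b ((hh.2 u hu b).2 ⟨hb, hub⟩)).symm)

/-- Three hexagons meet at a vertex, and each pair of its edges bounds exactly one of them. -/
theorem hexagon_eq_of_two_neighbors {h h' u a b : ℤ × ℤ} (hodd : (h.1 + h.2) % 2 = 1)
    (hodd' : (h'.1 + h'.2) % 2 = 1) (hab : a ≠ b) (hua : hexLattice.Adj u a)
    (hub : hexLattice.Adj u b) (hu : u ∈ hexVerts h) (hu' : u ∈ hexVerts h') (ha : a ∈ hexVerts h)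
    (ha' : a ∈ hexVerts h') (hb : b ∈ hexVerts h) (hb' : b ∈ hexVerts h') : h = h' := by
  obtain ⟨r, c⟩ := h
  obtain ⟨r', c'⟩ := h'
  obtain ⟨u1, u2⟩ := u
  obtain ⟨a1, a2⟩ := a
  obtain ⟨b1, b2⟩ := b
  rw [hexLattice_adj] at hua hub
  rw [mem_hexVerts] at hu hu' ha ha' hb hb'
  simp only [ne_eq, Prod.mk.injEq] at *
  rcases hua with ⟨rfl, rfl | rfl⟩ | ⟨rfl, ⟨rfl, ha3⟩ | ⟨rfl, ha3⟩⟩ <;>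
    rcases hub with ⟨hb1, hb2 | hb2⟩ | ⟨hb1, ⟨hb2, hb3⟩ | ⟨hb2, hb3⟩⟩ <;> omega

theorem IsHexComponent.eq {D : hexLattice.Subgraph} {h h' u : ℤ × ℤ} (hh : IsHexComponent D h)
    (hh' : IsHexComponent D h') (hu : u ∈ hexVerts h) (hu' : u ∈ hexVerts h') : h = h' := by
  obtain ⟨a, b, hab, ha, hb, hua, hub, -⟩ := exists_two_neighbors hh.1 hu
  exact hexagon_eq_of_two_neighbors hh.1 hh'.1 hab hua hub hu hu' ha
    ((hh'.2 u hu' a).1 ((hh.2 u hu a).2 ⟨ha, hua⟩)).1 hb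
    ((hh'.2 u hu' b).1 ((hh.2 u hu b).2 ⟨hb, hub⟩)).1

theorem IsHexComponent.exists_embedding {D : hexLattice.Subgraph} {h : ℤ × ℤ}
    (hh : IsHexComponent D h) : ∃ f : SimpleGraph.cycleGraph 6 ↪g D.coe,
      (∀ w x, D.coe.Adj (f w) x → x ∈ Set.range f) ∧
        ∀ v : D.verts, v ∈ Set.range f ↔ (v : ℤ × ℤ) ∈ hexVerts h := by
  have hmem : ∀ i, hexVertex h i ∈ hexVerts h := fun i => range_hexVertex h ▸ ⟨i, rfl⟩
  have hrange : ∀ v : D.verts, (∃ i, (⟨hexVertex h i, hh.mem_verts (hmem i)⟩ : D.verts) = v) ↔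
      (v : ℤ × ℤ) ∈ hexVerts h := by
    intro v
    rw [← range_hexVertex]
    exact exists_congr fun i => Subtype.ext_iff
  refine ⟨⟨⟨fun i => ⟨hexVertex h i, hh.mem_verts (hmem i)⟩, fun i j hij =>
    hexVertex_injective h (congrArg Subtype.val hij)⟩, ?_⟩, ?_, hrange⟩
  · intro i j
    change D.Adj (hexVertex h i) (hexVertex h j) ↔ _
    rw [hh.2 _ (hmem i), hexVertex_adj hh.1]
    exact and_iff_right (hmem j)
  · intro i x hx
    exact (hrange x).2 ((hh.2 _ (hmem i) x).1 hx).1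

theorem IsHexComponent.supp_eq {D : hexLattice.Subgraph} {h : ℤ × ℤ} (hh : IsHexComponent D h)
    {v : D.verts} (hv : (v : ℤ × ℤ) ∈ hexVerts h) :
    (D.coe.connectedComponentMk v).supp = {u : D.verts | (u : ℤ × ℤ) ∈ hexVerts h} ∧
      Nonempty ((D.coe.connectedComponentMk v).toSimpleGraph ≃g SimpleGraph.cycleGraph 6) := by
  obtain ⟨f, hf, hr⟩ := hh.exists_embedding
  obtain ⟨i, rfl⟩ := (hr v).2 hv
  refine ⟨?_, SimpleGraph.nonempty_iso_of_closed SimpleGraph.cycleGraph_connected f hf i⟩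
  rw [SimpleGraph.supp_eq_range_of_closed SimpleGraph.cycleGraph_connected f hf]
  ext u
  exact hr u

theorem exists_isHexComponent {D : hexLattice.Subgraph} (v : D.verts)
    (e : (D.coe.connectedComponentMk v).toSimpleGraph ≃g SimpleGraph.cycleGraph 6) :
    ∃ h, IsHexComponent D h ∧ (v : ℤ × ℤ) ∈ hexVerts h := by
  obtain ⟨f, hf, hr⟩ := SimpleGraph.ConnectedComponent.exists_embedding _ e
  have hcyc : ∀ i j : Fin 6, (SimpleGraph.cycleGraph 6).Adj i j ↔ i - j = 1 ∨ j - i = 1 :=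
    fun i j => SimpleGraph.cycleGraph_adj
  have hadj : ∀ i j, D.Adj (f i) (f j) ↔ i - j = 1 ∨ j - i = 1 := fun i j =>
    (f.map_adj_iff (v := i) (w := j)).trans (hcyc i j)
  have hinj : Function.Injective fun i => (f i : ℤ × ℤ) := fun i j hij =>
    f.injective (Subtype.ext hij)
  obtain ⟨r, c, hodd, hmem⟩ := exists_hexagon_of_closed_walk (x := fun i => (f i : ℤ × ℤ).1)
    (y := fun i => (f i : ℤ × ℤ).2)
    (fun i => D.adj_sub ((hadj i (i + 1)).2 (Or.inr (by simp))))
    (fun i h1 h2 => by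
      have hne : ∀ i : Fin 6, i ≠ i + 2 := by decide
      exact hne i (hinj (Prod.ext h1 h2)))
  have hrange : Set.range (fun i => (f i : ℤ × ℤ)) = hexVerts (r, c) := by
    apply Set.eq_of_subset_of_ncard_le
    · rintro _ ⟨i, rfl⟩
      exact hmem i
    · rw [ncard_hexVerts, ← Set.image_univ, Set.ncard_image_of_injective _ hinj, Set.ncard_univ,
        Nat.card_fin]
    · rw [← range_hexVertex]
      exact Set.finite_range _
  refine ⟨(r, c), ⟨hodd, ?_⟩, ?_⟩
  · intro u hu w
    have hu' := hu
    rw [← hrange] at hu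
    obtain ⟨i, rfl⟩ := hu
    constructor
    · intro h
      refine ⟨?_, D.adj_sub h⟩
      obtain ⟨j, hj⟩ := hf i ⟨w, h.snd_mem⟩ h
      rw [← hrange]
      exact ⟨j, congrArg Subtype.val hj⟩
    -- Inside the hexagon `u` has only two lattice neighbours, and its two distinct neighbours on
    -- the cycle use up both, so no lattice edge of the hexagon at `u` is missing from `D`.
    · rintro ⟨hw, ha⟩
      obtain ⟨a, b, -, -, -, -, -, hab⟩ := exists_two_neighbors hodd hu'
      have d1 : D.Adj (f i) (f (i + 1)) := (hadj _ _).2 (Or.inr (by simp))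
      have d2 : D.Adj (f i) (f (i - 1)) := (hadj _ _).2 (Or.inl (by simp))
      have hne : (f (i + 1) : ℤ × ℤ) ≠ f (i - 1) := fun h => by
        have hne : ∀ i : Fin 6, i + 1 ≠ i - 1 := by decide
        exact hne i (hinj h)
      have h1 := hab _ (hmem (i + 1)) (D.adj_sub d1)
      have h2 := hab _ (hmem (i - 1)) (D.adj_sub d2)
      have h3 := hab w hw ha
      have h4 : w = f (i + 1) ∨ w = f (i - 1) := by
        rcases h1 with h1 | h1 <;> rcases h2 with h2 | h2 <;> rcases h3 with h3 | h3 <;>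
          first
            | exact absurd (h1.trans h2.symm) hne
            | exact Or.inl (h3.trans h1.symm)
            | exact Or.inr (h3.trans h2.symm)
      rcases h4 with rfl | rfl
      exacts [d1, d2]
  · have : v ∈ Set.range f := by
      rw [hr]
      rfl
    obtain ⟨i, rfl⟩ := this
    exact hmem i

theorem nonempty_iso_cycleGraph_iff {D : hexLattice.Subgraph} (v : D.verts) :
    Nonempty ((D.coe.connectedComponentMk v).toSimpleGraph ≃g SimpleGraph.cycleGraph 6) ↔
      ∃ h, IsHexComponent D h ∧ (v : ℤ × ℤ) ∈ hexVerts h :=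
  ⟨fun ⟨e⟩ => exists_isHexComponent v e, fun ⟨_, hh, hv⟩ => (hh.supp_eq hv).2⟩

theorem nonempty_iso_top_iff {D : hexLattice.Subgraph} (v : D.verts) :
    Nonempty ((D.coe.connectedComponentMk v).toSimpleGraph ≃g (⊤ : SimpleGraph (Fin 2))) ↔
      IsEdgeComponent D v := by
  constructor
  · rintro ⟨e⟩
    obtain ⟨f, hf, hr⟩ := SimpleGraph.ConnectedComponent.exists_embedding _ e
    have : v ∈ Set.range f := by
      rw [hr]
      rfl
    obtain ⟨i, rfl⟩ := this
    have hadj : ∀ i j, D.Adj (f i) (f j) ↔ i ≠ j := fun i j => f.map_adj_iff (v := i) (w := j)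
    have hun : ∀ i j x, i ≠ j → D.Adj (f i) x → x = f j := by
      intro i j x hij hx
      obtain ⟨k, hk⟩ := hf i ⟨x, hx.snd_mem⟩ hx
      obtain rfl : x = f k := (congrArg Subtype.val hk).symm
      rw [hadj] at hx
      obtain rfl : j = k := by omega
      rfl
    have hne : i ≠ i + 1 := by
      have : ∀ i : Fin 2, i ≠ i + 1 := by decide
      exact this i
    exact ⟨f (i + 1), (hadj _ _).2 hne, fun x => hun _ _ x hne, fun x => hun _ _ x hne.symm⟩
  · rintro ⟨w, hvw, hv, hw⟩
    have hne := (D.adj_sub hvw).ne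
    have hirr : ∀ u, ¬ D.Adj u u := fun u h => (D.adj_sub h).ne rfl
    let f : Fin 2 → D.verts := ![v, ⟨w, hvw.snd_mem⟩]
    have hinj : Function.Injective f := by
      intro i j h
      fin_cases i <;> fin_cases j <;> simp [f, Subtype.ext_iff, hne, hne.symm] at h ⊢
    let F : (⊤ : SimpleGraph (Fin 2)) ↪g D.coe := ⟨⟨f, hinj⟩, by
      intro i j
      change D.Adj (f i) (f j) ↔ _
      rw [SimpleGraph.top_adj]
      fin_cases i <;> fin_cases j <;> simp [f, hvw, hvw.symm, hirr]⟩
    refine SimpleGraph.nonempty_iso_of_closed SimpleGraph.connected_top F ?_ 0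
    intro i x hx
    fin_cases i
    · exact ⟨1, Subtype.ext (hv x hx).symm⟩
    · exact ⟨0, Subtype.ext (hw x hx).symm⟩

/-- Replaces isomorphism types of components by conditions that are checked vertex by vertex in the
lattice. -/
theorem isClarCover_iff {B D : hexLattice.Subgraph} : IsClarCover B D ↔ D ≤ B ∧ D.verts = B.verts ∧
    ∀ v ∈ D.verts, IsEdgeComponent D v ∨ ∃ h, IsHexComponent D h ∧ v ∈ hexVerts h := by
  refine and_congr_right fun _ => and_congr_right fun _ => ?_
  constructor
  · intro h v hv
    rw [← nonempty_iso_top_iff ⟨v, hv⟩, ← nonempty_iso_cycleGraph_iff ⟨v, hv⟩]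
    exact h _
  · intro h c
    induction c using SimpleGraph.ConnectedComponent.ind with
    | _ v =>
      rw [nonempty_iso_top_iff, nonempty_iso_cycleGraph_iff]
      exact h v v.2

theorem center_mem_hexVerts (h : ℤ × ℤ) : h ∈ hexVerts h := ⟨Or.inl rfl, Or.inr (Or.inl rfl)⟩

theorem clarOrder_eq_ncard (D : hexLattice.Subgraph) :
    clarOrder D = {h | IsHexComponent D h}.ncard := by
  symm
  -- The pair `h`, read as a vertex, is the top corner of the hexagon `h`.
  refine Set.ncard_congr (fun h hh => D.coe.connectedComponentMk
    ⟨h, IsHexComponent.mem_verts hh (center_mem_hexVerts h)⟩) ?_ ?_ ?_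
  · intro h hh
    exact (nonempty_iso_cycleGraph_iff _).2 ⟨h, hh, center_mem_hexVerts h⟩
  · intro h h' hh hh' heq
    have h1 := (IsHexComponent.supp_eq hh (v := ⟨h, hh.mem_verts (center_mem_hexVerts h)⟩)
      (center_mem_hexVerts h)).1
    have h2 : (⟨h', IsHexComponent.mem_verts hh' (center_mem_hexVerts h')⟩ : D.verts) ∈
        (D.coe.connectedComponentMk ⟨h, hh.mem_verts (center_mem_hexVerts h)⟩).supp := by
      rw [heq]
      rfl
    rw [h1] at h2
    exact IsHexComponent.eq hh hh' h2 (center_mem_hexVerts h')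
  · intro c hc
    induction c using SimpleGraph.ConnectedComponent.ind with
    | _ v =>
      obtain ⟨h, hh, hv⟩ := (nonempty_iso_cycleGraph_iff v).1 hc
      refine ⟨h, hh, ?_⟩
      have h1 := (hh.supp_eq hv).1
      have h2 : (⟨h, hh.mem_verts (center_mem_hexVerts h)⟩ : D.verts) ∈
          (D.coe.connectedComponentMk v).supp := by
        rw [h1]
        exact center_mem_hexVerts h
      exact h2

/-! ### Clar covers and sets of proper sextets -/

/-- The edge `uv` is one of the three double bonds of a proper sextet in the hexagon `h`. -/
def IsSextetEdge (h u v : ℤ × ℤ) : Prop :=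
  (u = (h.1, h.2 + 1) ∧ v = (h.1 + 1, h.2 + 1)) ∨ (u = (h.1 + 1, h.2 + 1) ∧ v = (h.1, h.2 + 1)) ∨
  (u = (h.1, h.2 - 1) ∧ v = (h.1, h.2)) ∨ (u = (h.1, h.2) ∧ v = (h.1, h.2 - 1)) ∨
  (u = (h.1 + 1, h.2 - 1) ∧ v = (h.1 + 1, h.2)) ∨ (u = (h.1 + 1, h.2) ∧ v = (h.1 + 1, h.2 - 1))

theorem isSextetEdge_iff {r c a b a' b' : ℤ} : IsSextetEdge (r, c) (a, b) (a', b') ↔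
    (a = r ∧ b = c + 1 ∧ a' = r + 1 ∧ b' = c + 1) ∨ (a = r + 1 ∧ b = c + 1 ∧ a' = r ∧ b' = c + 1) ∨
    (a = r ∧ b = c - 1 ∧ a' = r ∧ b' = c) ∨ (a = r ∧ b = c ∧ a' = r ∧ b' = c - 1) ∨
    (a = r + 1 ∧ b = c - 1 ∧ a' = r + 1 ∧ b' = c) ∨
      (a = r + 1 ∧ b = c ∧ a' = r + 1 ∧ b' = c - 1) := by
  simp only [IsSextetEdge, Prod.mk.injEq, and_assoc]

namespace IsSextetEdge

variable {h h' u v w : ℤ × ℤ}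

theorem symm (H : IsSextetEdge h u v) : IsSextetEdge h v u := by
  unfold IsSextetEdge at *
  tauto

theorem mem (H : IsSextetEdge h u v) : v ∈ hexVerts h := by
  obtain ⟨r, c⟩ := h
  obtain ⟨a, b⟩ := u
  obtain ⟨a', b'⟩ := v
  rw [isSextetEdge_iff] at H
  rw [mem_hexVerts]
  omega

theorem adj (hodd : (h.1 + h.2) % 2 = 1) (H : IsSextetEdge h u v) : hexLattice.Adj u v := by
  obtain ⟨r, c⟩ := h
  obtain ⟨a, b⟩ := u
  obtain ⟨a', b'⟩ := v
  rw [isSextetEdge_iff] at H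
  rw [hexLattice_adj]
  simp only at hodd
  omega

theorem unique (H : IsSextetEdge h u v) (H' : IsSextetEdge h u w) : v = w := by
  obtain ⟨r, c⟩ := h
  obtain ⟨a, b⟩ := u
  obtain ⟨a', b'⟩ := v
  obtain ⟨a'', b''⟩ := w
  rw [isSextetEdge_iff] at H H'
  rw [Prod.mk.injEq]
  rcases H with H | H | H | H | H | H <;> omega

theorem exists_of_mem (hu : u ∈ hexVerts h) : ∃ v, IsSextetEdge h u v := by
  obtain ⟨r, c⟩ := h
  obtain ⟨a, b⟩ := u
  obtain ⟨rfl | rfl, rfl | rfl | rfl⟩ := mem_hexVerts.1 hu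
  · exact ⟨(a, c), isSextetEdge_iff.2 (by omega)⟩
  · exact ⟨(a, b - 1), isSextetEdge_iff.2 (by omega)⟩
  · exact ⟨(a + 1, c + 1), isSextetEdge_iff.2 (by omega)⟩
  · exact ⟨(r + 1, c), isSextetEdge_iff.2 (by omega)⟩
  · exact ⟨(r + 1, b - 1), isSextetEdge_iff.2 (by omega)⟩
  · exact ⟨(r, c + 1), isSextetEdge_iff.2 (by omega)⟩

/-- The three edges of a sextet have three different directions (the parity conditions separate the
two slanted ones), so an edge can play only one role, and the role determines the hexagon. -/
theorem hexagon_eq (hodd : (h.1 + h.2) % 2 = 1) (hodd' : (h'.1 + h'.2) % 2 = 1)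
    (H : IsSextetEdge h u v) (H' : IsSextetEdge h' u v) : h = h' := by
  obtain ⟨r, c⟩ := h
  obtain ⟨r', c'⟩ := h'
  obtain ⟨a, b⟩ := u
  obtain ⟨a', b'⟩ := v
  rw [isSextetEdge_iff] at H H'
  rw [Prod.mk.injEq]
  simp only at hodd hodd'
  rcases H with H | H | H | H | H | H <;> omega

end IsSextetEdge

/-- The subgraph `K` together with the edges of the hexagons in `T`. -/
def addHexagons (K : hexLattice.Subgraph) (T : Set (ℤ × ℤ)) : hexLattice.Subgraph where
  verts := K.verts
  Adj u v := K.Adj u v ∨ ((u ∈ K.verts ∧ v ∈ K.verts) ∧ hexLattice.Adj u v ∧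
    ∃ h ∈ T, u ∈ hexVerts h ∧ v ∈ hexVerts h)
  adj_sub h := h.elim (fun h => K.adj_sub h) fun h => h.2.1
  edge_vert h := h.elim (fun h => K.edge_vert h) fun h => h.1.1
  symm := ⟨fun _ _ h => h.elim (fun h => Or.inl h.symm) fun ⟨hv, ha, h, hT, hu, hw⟩ =>
    Or.inr ⟨hv.symm, ha.symm, h, hT, hw, hu⟩⟩

/-- The subgraph `D` with each hexagonal component replaced by the double bonds of a proper
sextet. -/
def toMatching (D : hexLattice.Subgraph) : hexLattice.Subgraph where
  verts := D.verts
  Adj u v := D.Adj u v ∧ ∀ h, IsHexComponent D h → u ∈ hexVerts h → IsSextetEdge h u v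
  adj_sub h := D.adj_sub h.1
  edge_vert h := D.edge_vert h.1
  symm := ⟨fun u _ ⟨ha, hs⟩ => ⟨ha.symm, fun h hh hv =>
    (hs h hh ((hh.2 _ hv u).1 ha.symm).1).symm⟩⟩

namespace RegularStrip

variable {m n : ℕ} {S : RegularStrip m n} {K D : hexLattice.Subgraph} {T : Set (ℤ × ℤ)}
  {h u v w : ℤ × ℤ}

theorem odd_of_mem_hexagons (hh : h ∈ S.hexagons) : (h.1 + h.2) % 2 = 1 :=
  (S.mem_hexagons.1 hh).2.2.2

theorem mem_properSextets_iff : h ∈ S.properSextets K ↔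
    h ∈ S.hexagons ∧ ∀ u v, IsSextetEdge h u v → K.Adj u v := by
  refine and_congr_right fun _ => ⟨?_, fun H => ⟨?_, ?_, ?_⟩⟩
  · rintro ⟨h1, h2, h3⟩ u v (⟨rfl, rfl⟩ | ⟨rfl, rfl⟩ | ⟨rfl, rfl⟩ | ⟨rfl, rfl⟩ | ⟨rfl, rfl⟩ | ⟨rfl, rfl⟩)
    exacts [h1, h1.symm, h2, h2.symm, h3, h3.symm]
  · exact H _ _ (by simp [IsSextetEdge])
  · exact H _ _ (by simp [IsSextetEdge])
  · exact H _ _ (by simp [IsSextetEdge])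

theorem adj_iff_isSextetEdge (hK : IsKekule S.graph K) (hh : h ∈ S.properSextets K)
    (hu : u ∈ hexVerts h) : K.Adj u v ↔ IsSextetEdge h u v := by
  rw [mem_properSextets_iff] at hh
  refine ⟨fun hv => ?_, hh.2 u v⟩
  obtain ⟨w, hw⟩ := IsSextetEdge.exists_of_mem hu
  have huw := hh.2 u w hw
  rwa [(hK.2.2 huw.fst_mem).unique hv huw]

/-- The edge of `K` at a common vertex is a sextet edge of both hexagons. Thus proper sextets are
disjoint, and any set of them can be turned into hexagonal components. -/
theorem eq_of_mem_properSextets {h' : ℤ × ℤ} (hK : IsKekule S.graph K)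
    (hh : h ∈ S.properSextets K) (hh' : h' ∈ S.properSextets K) (hu : u ∈ hexVerts h)
    (hu' : u ∈ hexVerts h') : h = h' := by
  obtain ⟨w, hw⟩ := IsSextetEdge.exists_of_mem hu
  exact hw.hexagon_eq (odd_of_mem_hexagons hh.1) (odd_of_mem_hexagons hh'.1)
    ((adj_iff_isSextetEdge hK hh' hu').1 ((adj_iff_isSextetEdge hK hh hu).2 hw))

theorem isHexComponent_addHexagons (hK : IsKekule S.graph K) (hT : T ⊆ S.properSextets K)
    (hh : h ∈ T) : IsHexComponent (addHexagons K T) h := by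
  have hodd := odd_of_mem_hexagons (hT hh).1
  refine ⟨hodd, fun u hu w => ⟨?_, ?_⟩⟩
  · rintro (hw | ⟨-, ha, h', hh', hu', hw'⟩)
    · exact ⟨((adj_iff_isSextetEdge hK (hT hh) hu).1 hw).mem, K.adj_sub hw⟩
    · rw [eq_of_mem_properSextets hK (hT hh) (hT hh') hu hu']
      exact ⟨hw', ha⟩
  · rintro ⟨hw, ha⟩
    refine Or.inr ⟨⟨?_, ?_⟩, ha, h, hh, hu, hw⟩
    · rw [hK.2.1]
      exact ⟨h, (hT hh).1, hu⟩
    · rw [hK.2.1]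
      exact ⟨h, (hT hh).1, hw⟩

theorem isEdgeComponent_addHexagons (hK : IsKekule S.graph K) (hT : T ⊆ S.properSextets K)
    (hv : v ∈ K.verts) (hvT : ∀ h ∈ T, v ∉ hexVerts h) : IsEdgeComponent (addHexagons K T) v := by
  obtain ⟨w, hw, hun⟩ := hK.2.2 hv
  refine ⟨w, Or.inl hw, ?_, ?_⟩
  · rintro x (hx | ⟨-, -, h, hh, hvh, -⟩)
    · exact hun x hx
    · exact absurd hvh (hvT h hh)
  · rintro x (hx | ⟨-, -, h, hh, hwh, -⟩)
    · exact (hK.2.2 hw.snd_mem).unique hx hw.symm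
    · exact absurd ((adj_iff_isSextetEdge hK (hT hh) hwh).1 hw.symm).mem (hvT h hh)

theorem isHexComponent_addHexagons_iff (hK : IsKekule S.graph K) (hT : T ⊆ S.properSextets K) :
    IsHexComponent (addHexagons K T) h ↔ h ∈ T := by
  refine ⟨fun hh => ?_, isHexComponent_addHexagons hK hT⟩
  by_contra hn
  refine hh.not_isEdgeComponent (center_mem_hexVerts h) (isEdgeComponent_addHexagons hK hT
    (hh.mem_verts (center_mem_hexVerts h)) fun h' hh' hv => hn ?_)
  rwa [hh.eq (isHexComponent_addHexagons hK hT hh') (center_mem_hexVerts h) hv]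

theorem isClarCover_addHexagons (hK : IsKekule S.graph K) (hT : T ⊆ S.properSextets K) :
    IsClarCover S.graph (addHexagons K T) := by
  rw [isClarCover_iff]
  refine ⟨⟨hK.1.1, ?_⟩, hK.2.1, fun v hv => ?_⟩
  · rintro u v (h | ⟨-, ha, h, hh, hu, hv⟩)
    · exact hK.1.2 h
    · exact ⟨ha, h, (hT hh).1, hu, hv⟩
  · by_cases hvT : ∀ h ∈ T, v ∉ hexVerts h
    · exact Or.inl (isEdgeComponent_addHexagons hK hT hv hvT)
    · push Not at hvT
      obtain ⟨h, hh, hvh⟩ := hvT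
      exact Or.inr ⟨h, isHexComponent_addHexagons hK hT hh, hvh⟩

theorem toMatching_addHexagons (hK : IsKekule S.graph K) (hT : T ⊆ S.properSextets K) :
    toMatching (addHexagons K T) = K := by
  refine SimpleGraph.Subgraph.ext rfl ?_
  funext u v
  apply propext
  constructor
  · rintro ⟨h | ⟨-, -, h, hh, hu, -⟩, hs⟩
    · exact h
    · exact (adj_iff_isSextetEdge hK (hT hh) hu).2 (hs h (isHexComponent_addHexagons hK hT hh) hu)
  · intro ha
    refine ⟨Or.inl ha, fun h hh hu => ?_⟩
    rw [isHexComponent_addHexagons_iff hK hT] at hh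
    exact (adj_iff_isSextetEdge hK (hT hh) hu).1 ha

theorem toMatching_adj_iff (hh : IsHexComponent D h) (hu : u ∈ hexVerts h) :
    (toMatching D).Adj u v ↔ IsSextetEdge h u v := by
  refine ⟨fun H => H.2 h hh hu, fun H => ⟨(hh.2 u hu v).2 ⟨H.mem, H.adj hh.1⟩, ?_⟩⟩
  intro h' hh' hu'
  rwa [hh'.eq hh hu' hu]

theorem isKekule_toMatching (hD : IsClarCover S.graph D) : IsKekule S.graph (toMatching D) := by
  rw [isClarCover_iff] at hD
  refine ⟨⟨hD.1.1, fun u v h => hD.1.2 h.1⟩, hD.2.1, fun v hv => ?_⟩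
  rcases hD.2.2 v hv with he | ⟨h, hh, hvh⟩
  · have he' := he
    obtain ⟨w, hw, hun, -⟩ := he
    exact ⟨w, ⟨hw, fun h hh hv => absurd he' (hh.not_isEdgeComponent hv)⟩, fun x hx => hun x hx.1⟩
  · obtain ⟨w, hw⟩ := IsSextetEdge.exists_of_mem hvh
    refine ⟨w, (toMatching_adj_iff hh hvh).2 hw, fun x hx => ?_⟩
    exact ((toMatching_adj_iff hh hvh).1 hx).unique hw

/-- A priori `h` is any hexagon of the lattice; its two vertical edges lie in the strip and place it
between the ends of its tier. -/
theorem mem_hexagons_of_isHexComponent (hD : IsClarCover S.graph D) (hh : IsHexComponent D h) :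
    h ∈ S.hexagons := by
  obtain ⟨r, c⟩ := h
  have hodd := hh.1
  simp only at hodd
  have key : ∀ b, (b = c - 1 ∨ b = c + 1) → S.graph.Adj (r, b) (r + 1, b) := fun b hb =>
    hD.1.2 ((hh.2 (r, b) (mem_hexVerts.2 (by omega)) (r + 1, b)).2
      ⟨mem_hexVerts.2 (by omega), hexLattice_adj.2 (by omega)⟩)
  have h1 := S.adj_vertical.1 (key _ (Or.inl rfl))
  have h2 := S.adj_vertical.1 (key _ (Or.inr rfl))
  exact S.mem_hexagons.2 (by omega)

theorem isHexComponent_subset_properSextets (hD : IsClarCover S.graph D) :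
    {h | IsHexComponent D h} ⊆ S.properSextets (toMatching D) := fun _ hh =>
  mem_properSextets_iff.2 ⟨mem_hexagons_of_isHexComponent hD hh, fun _ _ he =>
    (toMatching_adj_iff hh he.symm.mem).2 he⟩

theorem addHexagons_toMatching (hD : IsClarCover S.graph D) :
    addHexagons (toMatching D) {h | IsHexComponent D h} = D := by
  refine SimpleGraph.Subgraph.ext rfl ?_
  funext u v
  apply propext
  constructor
  · rintro (h | ⟨-, ha, h, hh, hu, hv⟩)
    · exact h.1
    · exact ((show IsHexComponent D h from hh).2 u hu v).2 ⟨hv, ha⟩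
  · intro ha
    rcases (isClarCover_iff.1 hD).2.2 u ha.fst_mem with he | ⟨h, hh, huh⟩
    · exact Or.inl ⟨ha, fun h hh hu => absurd he (hh.not_isEdgeComponent hu)⟩
    · exact Or.inr ⟨⟨ha.fst_mem, ha.snd_mem⟩, D.adj_sub ha, h, hh, huh, ((hh.2 u huh v).1 ha).1⟩

variable (S) in
/-- Clar covers of order `k` correspond to Kekulé structures with `k` marked proper sextets. -/
noncomputable def clarCoverEquiv (k : ℕ) : {D | IsClarCover S.graph D ∧ clarOrder D = k} ≃
    Σ K : {K // IsKekule S.graph K}, {T : Set (ℤ × ℤ) // T ⊆ S.properSextets K.1 ∧ T.ncard = k} where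
  toFun D := ⟨⟨toMatching D.1, isKekule_toMatching D.2.1⟩, {h | IsHexComponent D.1 h},
    isHexComponent_subset_properSextets D.2.1, by rw [← clarOrder_eq_ncard]; exact D.2.2⟩
  invFun p := ⟨addHexagons p.1.1 p.2.1, isClarCover_addHexagons p.1.2 p.2.2.1, by
    rw [clarOrder_eq_ncard]
    simp only [isHexComponent_addHexagons_iff p.1.2 p.2.2.1]
    exact p.2.2.2⟩
  left_inv D := Subtype.ext (addHexagons_toMatching D.2.1)
  right_inv := by
    rintro ⟨⟨K, hK⟩, T, hT, hk⟩
    have h1 : (⟨toMatching (addHexagons K T), isKekule_toMatching (isClarCover_addHexagons hK hT)⟩ :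
        {K // IsKekule S.graph K}) = ⟨K, hK⟩ := Subtype.ext (toMatching_addHexagons hK hT)
    refine Sigma.subtype_ext h1 ?_
    ext h
    exact isHexComponent_addHexagons_iff hK hT

theorem _root_.card_subsets_ncard_eq {α : Type*} {s : Set α} (hs : s.Finite) (k : ℕ) :
    Nat.card {T : Set α // T ⊆ s ∧ T.ncard = k} = s.ncard.choose k := by
  classical
  lift s to Finset α using hs
  rw [Set.ncard_coe_finset, ← Finset.card_powersetCard, ← Nat.card_eq_finsetCard]
  symm
  refine Nat.card_congr (Equiv.ofBijective (fun T => ⟨(T.1 : Set α), ?_, ?_⟩) ⟨?_, ?_⟩)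
  · exact Finset.coe_subset.2 (Finset.mem_powersetCard.1 T.2).1
  · rw [Set.ncard_coe_finset]
    exact (Finset.mem_powersetCard.1 T.2).2
  · intro T T' h
    exact Subtype.ext (Finset.coe_injective (congrArg Subtype.val h))
  · rintro ⟨T, hT, hk⟩
    lift T to Finset α using (Finset.finite_toSet s).subset hT
    rw [Set.ncard_coe_finset] at hk
    exact ⟨⟨T, Finset.mem_powersetCard.2 ⟨Finset.coe_subset.1 hT, hk⟩⟩, rfl⟩

theorem finite_hexagons (S : RegularStrip m n) : S.hexagons.Finite := by
  refine (Set.finite_iUnion fun k : Fin m => (Set.finite_Iio (S.len k)).image fun j : ℕ =>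
    ((((k : ℕ) : ℤ), S.first k + 2 * (j : ℤ) + 1) : ℤ × ℤ)).subset ?_
  rintro h ⟨k, j, hj, rfl⟩
  exact Set.mem_iUnion.2 ⟨k, j, hj, rfl⟩

theorem finite_properSextets (S : RegularStrip m n) (K : hexLattice.Subgraph) :
    (S.properSextets K).Finite :=
  S.finite_hexagons.subset fun _ h => h.1

theorem clarCount_eq (S : RegularStrip m n) [Fintype {K // IsKekule S.graph K}] (k : ℕ) :
    clarCount S.graph k =
      ∑ K : {K // IsKekule S.graph K}, (S.properSextets K.1).ncard.choose k := by
  have : ∀ K : {K // IsKekule S.graph K},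
      Finite {T : Set (ℤ × ℤ) // T ⊆ S.properSextets K.1 ∧ T.ncard = k} := fun K =>
    (((S.finite_properSextets K.1).finite_subsets).subset fun T hT => hT.1).to_subtype
  rw [clarCount, ← Nat.card_coe_set_eq, Nat.card_congr (S.clarCoverEquiv k), Nat.card_sigma]
  simp only [card_subsets_ncard_eq (S.finite_properSextets _)]

/-- A Kekulé structure with `p` proper sextets yields `p.choose k` Clar covers of order `k`; sum
over `k` by the binomial theorem. -/
theorem zzPoly_eq_sum (S : RegularStrip m n) [Fintype {K // IsKekule S.graph K}] :
    zzPoly S.graph =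
      ∑ K : {K // IsKekule S.graph K}, (X + 1 : ℤ[X]) ^ (S.properSextets K.1).ncard := by
  have hle : ∀ K, (S.properSextets K).ncard ≤ S.hexagons.ncard := fun K =>
    Set.ncard_le_ncard (fun _ h => h.1) S.finite_hexagons
  have hord : ∀ D, IsClarCover S.graph D → clarOrder D ≤ S.hexagons.ncard := by
    intro D hD
    rw [clarOrder_eq_ncard]
    exact Set.ncard_le_ncard (fun h hh => mem_hexagons_of_isHexComponent hD hh) S.finite_hexagons
  have hbdd : BddAbove {k | ∃ D, IsClarCover S.graph D ∧ clarOrder D = k} :=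
    ⟨S.hexagons.ncard, by rintro k ⟨D, hD, rfl⟩; exact hord D hD⟩
  have hcl : clarNumber S.graph ≤ S.hexagons.ncard :=
    csSup_le' (by rintro k ⟨D, hD, rfl⟩; exact hord D hD)
  -- Lets the range of `k` extend to the number of hexagons, a bound that serves all `K` at once.
  have hzero : ∀ k, clarNumber S.graph < k → clarCount S.graph k = 0 := by
    intro k hk
    have : {D : hexLattice.Subgraph | IsClarCover S.graph D ∧ clarOrder D = k} = ∅ := by
      rw [Set.eq_empty_iff_forall_notMem]
      rintro D hD
      exact absurd (le_csSup hbdd ⟨D, hD⟩) (not_le.2 hk)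
    rw [clarCount, this, Set.ncard_empty]
  have hpow : ∀ p ≤ S.hexagons.ncard, (X + 1 : ℤ[X]) ^ p =
      ∑ k ∈ Finset.range (S.hexagons.ncard + 1), C ((p.choose k : ℕ) : ℤ) * X ^ k := by
    intro p hp
    rw [add_pow, Finset.sum_subset (Finset.range_subset_range.2 (Nat.succ_le_succ hp))]
    · refine Finset.sum_congr rfl fun k _ => ?_
      simp [mul_comm]
    · intro k _ hk
      rw [Finset.mem_range, not_lt] at hk
      rw [Nat.choose_eq_zero_of_lt hk]
      simp
  rw [zzPoly, Finset.sum_subset (Finset.range_subset_range.2 (Nat.succ_le_succ hcl))]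
  · simp only [hpow _ (hle _)]
    rw [Finset.sum_comm]
    refine Finset.sum_congr rfl fun k _ => ?_
    rw [clarCount_eq, ← Finset.sum_mul]
    simp
  · intro k _ hk
    rw [Finset.mem_range, not_lt] at hk
    rw [hzero k hk]
    simp

theorem zzPoly_eq (hS : ∃ K, IsKekule S.graph K) :
    zzPoly S.graph = (extStrictOrderPoly S.Dib n).comp (X + 1) := by
  classical
  obtain ⟨Φ, hΦ⟩ := exists_equiv_kekule hS
  have : Fintype {g : S.Dib → Fin (n + 1) // Monotone g} := Fintype.ofFinite _
  have : Fintype {K // IsKekule S.graph K} := Fintype.ofEquiv _ Φ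
  rw [zzPoly_eq_sum, ← Φ.sum_comp, extStrictOrderPoly, Polynomial.sum_comp,
    ← Finset.sum_fiberwise Finset.univ fun g : {g : S.Dib → Fin (n + 1) // Monotone g} => minFib g.1]
  refine Finset.sum_congr rfl fun A _ => ?_
  rw [Finset.sum_congr rfl (g := fun _ => (X + 1 : ℤ[X]) ^ A.card), Finset.sum_const,
    ← card_minFib_eq, Nat.card_eq_fintype_card, Fintype.card_subtype]
  · simp
  · intro g hg
    rw [hΦ, (Finset.mem_filter.1 hg).2]

end RegularStrip

theorem mainTheorem1 (m n : ℕ) (S : RegularStrip m n) (hS : ∃ K, IsKekule S.graph K) :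
    (∀ k : ℕ, S.kekuleCount k =
      ∑ A ∈ (Finset.univ : Finset S.Dib).powersetCard k, strictOrderPoly A n) ∧
    zzPoly S.graph = (extStrictOrderPoly S.Dib n).comp (X + 1) :=
  ⟨RegularStrip.kekuleCount_eq hS, RegularStrip.zzPoly_eq hS⟩
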